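/- **Definitions.** An admissible rectangle is a set $I\times J\subset\mathbb R^2$ with $I,J$ closed, possibly unbounded, intervals with non-empty interior; its corners are the points of $\partial I\times\partial J$. A polyrectangle $W$ is a finite union of admissible rectangles no two of which have a common corner; $\mathrm{corners}(W)$ is the set of its apparent corners, i.e. the points of $\partial W$ near which $\partial W$ is not a horizontal or vertical straight line. For $A\subset\mathbb R^2$, $\Gamma(A)$ is the set of bounded connected components of $A$, and for $\varepsilon>0$ $$A^{\varepsilon}=\bigcup_{x\in\varepsilon\mathbb Z^2\cap A}\bigl(x+\varepsilon[-1/2,1/2)^2\bigr).$$ A function $f:W\to\mathbb R$ is $\mathcal C^{1,1}$ if it is differentiable (up to the boundary of $W$) and its gradient is locally Lipschitz on $W$. For $g:W\to\mathbb R$, $\mathrm{Lip}(g)=\sup_{x\ne y\in W}|g(x)-g(y)|/\|x-y\|\in[0,\infty]$. The quantities below take values in $[0,\infty]$, with $1/0=\infty$ and $0\cdot\infty=0$; $\mathcal H^1$ is the one-dimensional Hausdorff measure. For $\lambda\in\mathbb R$ put $$I_{\alpha,\beta}=\mathrm{Lip}(f)^{\alpha}\bigl(\mathrm{Lip}(\partial_1f)^{2\beta}+\mathrm{Lip}(\partial_2f)^{2\beta}\bigr)\int_W\frac{dx}{|f(x)-\lambda|^{\alpha}\,|\partial_1f(x)\,\partial_2f(x)|^{\beta}},$$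 $$I'_{\alpha',\beta'}=\mathrm{Lip}(f)^{\alpha'}\sum_{i=1}^{2}\mathrm{Lip}(\partial_if)^{\beta'}\int_{\partial W}\frac{\mathcal H^1(dx)}{|f(x)-\lambda|^{\alpha'}\,|\partial_if(x)|^{\beta'}}.$$ **Theorem.** To each polyrectangle $W$ one can associate a number $\varepsilon(W)>0$, depending only on $W$, such that the following holds. Let $\alpha,\beta,\alpha',\beta'>0$ with $\alpha+2\beta>2$ and $\alpha'+\beta'>1$. Let $W$ be a polyrectangle, $f:W\to\mathbb R$ a $\mathcal C^{1,1}$ function, $\lambda\in\mathbb R$, and let $F=\{x\in W:f(x)\le\lambda\}$ or $F=\{x\in W:f(x)<\lambda\}$. Assume that $F\cap W$ is bounded and that $\nabla f$ does not vanish on the boundary $\partial F$ of $F$ relative to $W$. Then for all $0<\varepsilon<\varepsilon(W)$, $$\max\bigl(\#\Gamma((F\cap W)^{\varepsilon}),\ \#\Gamma(F\cap W)\bigr)\le C\,\bigl(I_{\alpha,\beta}+I'_{\alpha',\beta'}+\#\mathrm{corners}(W)\bigr),$$ where $C\in(0,\infty)$ depends only on $\mathrm{diam}(F\cap W)$ and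 on $\alpha,\beta,\alpha',\beta'$. -/

import Mathlib

open MeasureTheory Set
open scoped ENNReal

/-- The Euclidean plane `ℝ²`. -/
abbrev Plane : Type := EuclideanSpace ℝ (Fin 2)

/-- The class `Γ(A)` of bounded connected components of `A ⊆ ℝ²`. -/
def boundedComponents (A : Set Plane) : Set (Set Plane) :=
  {C | (∃ x ∈ A, C = connectedComponentIn A x) ∧ Bornology.IsBounded C}

/-- A closed, possibly unbounded, non-degenerate interval of `ℝ`. -/
def IsClosedInterval (I : Set ℝ) : Prop :=
  IsClosed I ∧ I.OrdConnected ∧ (interior I).Nonempty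

/-- The rectangle `I × J` as a subset of the plane. -/
def rect (I J : Set ℝ) : Set Plane := {x | x 0 ∈ I ∧ x 1 ∈ J}

/-- The corners of the rectangle `I × J`: both coordinates are (finite) end points. -/
def rectCorners (I J : Set ℝ) : Set Plane := {x | x 0 ∈ frontier I ∧ x 1 ∈ frontier J}

/-- A polyrectangle: a finite union of rectangles, no two of which share a corner. -/
def IsPolyrectangle (W : Set Plane) : Prop :=
  ∃ (n : ℕ) (I J : Fin n → Set ℝ),
    (∀ k, IsClosedInterval (I k) ∧ IsClosedInterval (J k)) ∧
    (∀ k l, k ≠ l → Disjoint (rectCorners (I k) (J k)) (rectCorners (I l) (J l))) ∧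
    W = ⋃ k, rect (I k) (J k)

/-- The apparent corners of `W` (salient or reentrant): the points of `∂W` near which `∂W` is
not a horizontal or vertical straight line. -/
def corners (W : Set Plane) : Set Plane :=
  {x ∈ frontier W | ¬ ∃ r > (0 : ℝ), ∃ i : Fin 2,
    frontier W ∩ Metric.ball x r = {y ∈ Metric.ball x r | y i = x i}}

/-- `f : W → ℝ` is of class `C^{1,1}`: differentiable on `W` with locally Lipschitz derivative.
(Values of `f` outside `W` are irrelevant.) -/
def IsC11On (f : Plane → ℝ) (W : Set Plane) : Prop :=
  DifferentiableOn ℝ f W ∧ LocallyLipschitzOn W (fderivWithin ℝ f W)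

/-- The partial derivative `∂ᵢ f` of `f : W → ℝ`. -/
noncomputable def partialOn (W : Set Plane) (f : Plane → ℝ) (i : Fin 2) (x : Plane) : ℝ :=
  fderivWithin ℝ f W x (EuclideanSpace.single i 1)

/-- The Lipschitz constant of `g : W → ℝ`, equal to `∞` if `g` is not Lipschitz. The terms with
`x = y` are `0 / 0 = 0`. -/
noncomputable def lipConst (W : Set Plane) (g : Plane → ℝ) : ℝ≥0∞ :=
  ⨆ x ∈ W, ⨆ y ∈ W, edist (g x) (g y) / edist x y

/-- `F_λ(f) = {x ∈ W : f(x) ≤ λ}`. -/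
def sublevel (W : Set Plane) (f : Plane → ℝ) (lam : ℝ) : Set Plane := {x ∈ W | f x ≤ lam}

/-- `F_{λ⁻}(f) = {x ∈ W : f(x) < λ}`. -/
def strictSublevel (W : Set Plane) (f : Plane → ℝ) (lam : ℝ) : Set Plane := {x ∈ W | f x < lam}

/-- The boundary of `F ⊆ W` in the topological space `W`. -/
def relFrontier (W F : Set Plane) : Set Plane := W ∩ closure F ∩ closure (W \ F)

/-- The lattice `ε ℤ²`. -/
def gridPoints (ε : ℝ) : Set Plane := {x | ∃ z : Fin 2 → ℤ, ∀ i, x i = ε * z i}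

/-- The Gauss approximation `A^ε`, the union of the half-open pixels `x + ε [-1/2, 1/2)²` over
`x ∈ ε ℤ² ∩ A`. -/
def gaussApprox (ε : ℝ) (A : Set Plane) : Set Plane :=
  ⋃ x ∈ gridPoints ε ∩ A, {y | ∀ i, y i - x i ∈ Ico (-(ε / 2)) (ε / 2)}

/-- The weighted singular integral `I_{α,β}` over `W`, with values in `[0, ∞]`. The integrand is
`∞` where its denominator vanishes. -/
noncomputable def areaTerm (W : Set Plane) (f : Plane → ℝ) (lam α β : ℝ) : ℝ≥0∞ :=
  lipConst W f ^ α *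
    (lipConst W (partialOn W f 0) ^ (2 * β) + lipConst W (partialOn W f 1) ^ (2 * β)) *
    ∫⁻ x in W, (ENNReal.ofReal
      (|f x - lam| ^ α * |partialOn W f 0 x * partialOn W f 1 x| ^ β))⁻¹

/-- The weighted singular integral `I'_{α',β'}` over `∂W`, with respect to the one-dimensional
Hausdorff measure. -/
noncomputable def boundaryTerm (W : Set Plane) (f : Plane → ℝ) (lam α' β' : ℝ) : ℝ≥0∞ :=
  lipConst W f ^ α' *
    ∑ i : Fin 2, lipConst W (partialOn W f i) ^ β' *
      ∫⁻ x in frontier W, (ENNReal.ofReal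
        (|f x - lam| ^ α' * |partialOn W f i x| ^ β'))⁻¹ ∂(Measure.hausdorffMeasure 1)

/-!
The number of components is bounded by letting each component own a part of `W` or of `∂W`, disjoint
from the parts of the others, on which the singular integral is bounded from below. The exponents
`α + 2 β > 2` and `α' + β' > 1` are what makes this contribution large for small components.

The mechanism is that of a *well* (`IsWell`): a segment of `W` parallel to the `j`-th axis, of
length `l`, at both ends of which `f ≥ lam` while `f` is smaller and `≤ lam` at some point inside.
By the intermediate value theorem and Rolle's theorem `f - lam` and `∂ⱼ f` vanish somewhere on the
segment, so that `|f - lam| ≤ Lip(f) l` and `|∂ⱼ f| ≤ Lip(∂ⱼ f) l` near it; both Lipschitz constants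
are moreover positive, hence the products with `∞` behave well.

* If a set `A` has sections which consist of wells in both directions, with horizontal length `h`
  and vertical length at most `b`, the total height of `A`, then the integrand is at least
  `c / (h b)`. Integrating first over the horizontal sections and then over the height gives a lower
  bound that no longer depends on the size of `A` (`le_area_integral`). This applies to components
  that stay away from `∂W`, as well as to components of the Gauss approximation.
* A well of length `s` on a straight piece of `∂W` contributes `s ^ (1 - α' - β')` to the boundary
  integral (`le_edge_integral`).
* Every other component contains, or comes close to, a corner.

For the components of `F` the wells are maximal segments on which `f < lam`; when a component only
touches `∂W` with `f = lam` the boundary integral diverges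
(`IsSublevelSet.boundaryTerm_eq_top`). For the Gauss approximation the wells are maximal runs of
lattice points of `F` in a row or column. The scale `ε(W)` is chosen so that a square of radius
`ε < ε(W)` with no corner of `W` sees of `W` nothing, everything, or a half-plane parallel to an
axis (`IsPolyrectangle.exists_local_structure`).
-/


/-! ### Lipschitz constants and derivatives along the axes -/

/-- The `j`-th vector of the standard basis of the plane. -/
noncomputable abbrev axis (j : Fin 2) : Plane := EuclideanSpace.single j 1

lemma add_smul_axis_self (x : Plane) (t : ℝ) (j : Fin 2) : (x + t • axis j) j = x j + t := by
  simp [axis]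

lemma add_smul_axis_ne (x : Plane) (t : ℝ) {i j : Fin 2} (h : i ≠ j) :
    (x + t • axis j) i = x i := by
  simp [axis, h]

lemma dist_add_smul_axis (x : Plane) (s t : ℝ) (j : Fin 2) :
    dist (x + s • axis j) (x + t • axis j) = |s - t| := by
  rw [dist_add_left, dist_eq_norm, ← sub_smul, norm_smul, PiLp.norm_single]
  simp

lemma dist_le_abs_add_abs (x y : Plane) : dist x y ≤ |x 0 - y 0| + |x 1 - y 1| := by
  rw [EuclideanSpace.dist_eq, Fin.sum_univ_two, Real.dist_eq, Real.dist_eq]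
  refine Real.sqrt_le_iff.2 ⟨by positivity, ?_⟩
  nlinarith [abs_nonneg (x 0 - y 0), abs_nonneg (x 1 - y 1)]

lemma abs_coord_sub_le_dist (x y : Plane) (i : Fin 2) : |x i - y i| ≤ dist x y := by
  have h := PiLp.norm_apply_le (x - y) i
  rwa [Real.norm_eq_abs, PiLp.sub_apply, ← dist_eq_norm] at h

lemma edist_le_lipConst_mul {W : Set Plane} {g : Plane → ℝ} {x y : Plane} (hx : x ∈ W)
    (hy : y ∈ W) : edist (g x) (g y) ≤ lipConst W g * edist x y := by
  rcases eq_or_ne x y with rfl | hxy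
  · simp
  · refine (ENNReal.div_le_iff (by simpa using hxy) (edist_ne_top x y)).1 ?_
    exact le_trans (le_iSup₂ (f := fun y (_ : y ∈ W) => edist (g x) (g y) / edist x y) y hy)
      (le_iSup₂ (f := fun x (_ : x ∈ W) => ⨆ y ∈ W, edist (g x) (g y) / edist x y) x hx)

lemma lipConst_ne_zero {W : Set Plane} {g : Plane → ℝ} {x y : Plane} (hx : x ∈ W)
    (hy : y ∈ W) (h : g x ≠ g y) : lipConst W g ≠ 0 := by
  intro h0
  have := edist_le_lipConst_mul (g := g) hx hy
  rw [h0, zero_mul, nonpos_iff_eq_zero, edist_eq_zero] at this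
  exact h this

lemma ofReal_abs_sub_le {W : Set Plane} {g : Plane → ℝ} {x y : Plane} (hx : x ∈ W)
    (hy : y ∈ W) {l : ℝ} (hl : dist x y ≤ l) :
    ENNReal.ofReal |g x - g y| ≤ lipConst W g * ENNReal.ofReal l := by
  rw [← Real.dist_eq, ← edist_dist]
  refine (edist_le_lipConst_mul hx hy).trans ?_
  gcongr
  rw [edist_dist]
  exact ENNReal.ofReal_le_ofReal hl

lemma hasDerivWithinAt_axis {W : Set Plane} {f : Plane → ℝ} (hf : DifferentiableOn ℝ f W)
    {x : Plane} {j : Fin 2} {s : Set ℝ} (hs : ∀ t ∈ s, x + t • axis j ∈ W) {t : ℝ}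
    (ht : t ∈ s) :
    HasDerivWithinAt (fun t : ℝ => f (x + t • axis j)) (partialOn W f j (x + t • axis j)) s t := by
  have h1 : HasDerivWithinAt (fun t : ℝ => x + t • axis j) (axis j) s t := by
    simpa using (((hasDerivAt_id t).smul_const (axis j)).const_add x).hasDerivWithinAt
  exact (hf _ (hs t ht)).hasFDerivWithinAt.comp_hasDerivWithinAt t h1 hs

/-- Along a segment parallel to an axis on which `f` is not constant, the partial derivative in
that direction does not vanish identically. -/
lemma exists_partialOn_ne_zero {W : Set Plane} {f : Plane → ℝ} (hf : DifferentiableOn ℝ f W)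
    {x : Plane} {j : Fin 2} {b : ℝ} (hb : 0 ≤ b) (hs : ∀ t ∈ Icc 0 b, x + t • axis j ∈ W)
    (hne : f x ≠ f (x + b • axis j)) :
    ∃ t ∈ Icc 0 b, partialOn W f j (x + t • axis j) ≠ 0 := by
  by_contra! hcon
  have h := constant_of_has_deriv_right_zero (f := fun t : ℝ => f (x + t • axis j)) (a := 0)
    (b := b) (fun t ht => (hasDerivWithinAt_axis hf hs ht).continuousWithinAt)
    (fun t ht => by
      have h2 := hasDerivWithinAt_axis hf hs (Ico_subset_Icc_self ht)
      rw [hcon t (Ico_subset_Icc_self ht)] at h2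
      exact h2.mono_of_mem_nhdsWithin (Icc_mem_nhdsGE_of_mem ht))
  have := h b ⟨hb, le_rfl⟩
  simp only [zero_smul, add_zero] at this
  exact hne this.symm

/-- A well of `f` at level `lam` in direction `j`: the segment `x + [a, b] eⱼ` lies in `W`, and `f`
is at most `lam` at `x` but at least `lam`, and larger than at `x`, at both ends. -/
structure IsWell (W : Set Plane) (f : Plane → ℝ) (lam : ℝ) (j : Fin 2) (x : Plane) (a b : ℝ) :
    Prop where
  left : a ≤ 0
  right : 0 ≤ b
  mem : ∀ t ∈ Icc a b, x + t • axis j ∈ W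
  le : f x ≤ lam
  le_left : lam ≤ f (x + a • axis j)
  le_right : lam ≤ f (x + b • axis j)
  lt_left : f x < f (x + a • axis j)
  lt_right : f x < f (x + b • axis j)

namespace IsWell

variable {W : Set Plane} {f : Plane → ℝ} {lam : ℝ} {j : Fin 2} {x : Plane} {a b : ℝ}

lemma mem_center (h : IsWell W f lam j x a b) : x ∈ W := by
  simpa using h.mem 0 ⟨h.left, h.right⟩

lemma continuousOn (h : IsWell W f lam j x a b) (hf : DifferentiableOn ℝ f W) :
    ContinuousOn (fun t : ℝ => f (x + t • axis j)) (Icc a b) :=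
  fun _ ht => (hasDerivWithinAt_axis hf h.mem ht).continuousWithinAt

lemma lipConst_ne_zero (h : IsWell W f lam j x a b) : lipConst W f ≠ 0 :=
  _root_.lipConst_ne_zero h.mem_center (h.mem b ⟨h.left.trans h.right, le_rfl⟩) h.lt_right.ne

lemma exists_eq (h : IsWell W f lam j x a b) (hf : DifferentiableOn ℝ f W) :
    ∃ t ∈ Icc a b, f (x + t • axis j) = lam := by
  have h1 := intermediate_value_Icc h.right
    ((h.continuousOn hf).mono (Icc_subset_Icc_left h.left))
  obtain ⟨t, ht, hft⟩ := h1 ⟨by simpa using h.le, h.le_right⟩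
  exact ⟨t, ⟨h.left.trans ht.1, ht.2⟩, hft⟩

lemma exists_partialOn_eq_zero (h : IsWell W f lam j x a b) (hf : DifferentiableOn ℝ f W) :
    ∃ t ∈ Icc a b, partialOn W f j (x + t • axis j) = 0 := by
  have h0 : (0 : ℝ) ∈ Icc a b := ⟨h.left, h.right⟩
  obtain ⟨t, ht, hmin⟩ := isCompact_Icc.exists_isMinOn ⟨0, h0⟩ (h.continuousOn hf)
  have hle : f (x + t • axis j) ≤ f x := by simpa using hmin h0
  have hta : t ≠ a := by rintro rfl; exact absurd h.lt_left (not_lt.2 hle)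
  have htb : t ≠ b := by rintro rfl; exact absurd h.lt_right (not_lt.2 hle)
  have hn : Icc a b ∈ nhds t := Icc_mem_nhds (lt_of_le_of_ne ht.1 hta.symm)
    (lt_of_le_of_ne ht.2 htb)
  exact ⟨t, ht, (hmin.isLocalMin hn).hasDerivAt_eq_zero
    ((hasDerivWithinAt_axis hf h.mem ht).hasDerivAt hn)⟩

lemma lipConst_partialOn_ne_zero (h : IsWell W f lam j x a b) (hf : DifferentiableOn ℝ f W) :
    lipConst W (partialOn W f j) ≠ 0 := by
  obtain ⟨t, ht, h0⟩ := h.exists_partialOn_eq_zero hf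
  obtain ⟨s, hs, h1⟩ := exists_partialOn_ne_zero hf h.right
    (fun t ht => h.mem t ⟨h.left.trans ht.1, ht.2⟩) h.lt_right.ne
  exact _root_.lipConst_ne_zero (h.mem s ⟨h.left.trans hs.1, hs.2⟩) (h.mem t ht)
    (by rw [h0]; exact h1)

lemma abs_sub_le (h : IsWell W f lam j x a b) (hf : DifferentiableOn ℝ f W) {p : Plane} {l : ℝ}
    (hp : p ∈ W) (hl : ∀ t ∈ Icc a b, dist p (x + t • axis j) ≤ l) :
    ENNReal.ofReal |f p - lam| ≤ lipConst W f * ENNReal.ofReal l := by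
  obtain ⟨t, ht, h0⟩ := h.exists_eq hf
  rw [← h0]
  exact ofReal_abs_sub_le hp (h.mem t ht) (hl t ht)

lemma abs_partialOn_le (h : IsWell W f lam j x a b) (hf : DifferentiableOn ℝ f W) {p : Plane}
    {l : ℝ} (hp : p ∈ W) (hl : ∀ t ∈ Icc a b, dist p (x + t • axis j) ≤ l) :
    ENNReal.ofReal |partialOn W f j p| ≤ lipConst W (partialOn W f j) * ENNReal.ofReal l := by
  obtain ⟨t, ht, h0⟩ := h.exists_partialOn_eq_zero hf
  have := ofReal_abs_sub_le (g := partialOn W f j) hp (h.mem t ht) (hl t ht)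
  rwa [h0, sub_zero] at this

/-- Points of the segment itself see the well at a distance at most its length. -/
lemma dist_le (t : ℝ) (ht : t ∈ Icc a b) : ∀ s ∈ Icc a b,
    dist (x + t • axis j) (x + s • axis j) ≤ b - a := by
  intro s hs
  rw [dist_add_smul_axis, abs_le]
  constructor <;> linarith [ht.1, ht.2, hs.1, hs.2]

end IsWell

lemma eventually_lt_of_fderivWithin_neg {W : Set Plane} {f : Plane → ℝ}
    (hf : DifferentiableOn ℝ f W) {p v : Plane} (hp : p ∈ W)
    (hv : fderivWithin ℝ f W p v < 0) {r : ℝ} (hr : 0 < r)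
    (hW : ∀ t ∈ Ico 0 r, p + t • v ∈ W) :
    ∃ d : ℝ, 0 < d ∧ ∀ t ∈ Ioo 0 d, f (p + t • v) < f p := by
  have h1 : HasDerivWithinAt (fun t : ℝ => p + t • v) v (Ico 0 r) 0 := by
    simpa using (((hasDerivAt_id (0 : ℝ)).smul_const v).const_add p).hasDerivWithinAt
  have h2 : HasFDerivWithinAt f (fderivWithin ℝ f W p) W (p + (0 : ℝ) • v) := by
    simpa using (hf p hp).hasFDerivWithinAt
  have h3 := h2.comp_hasDerivWithinAt (0 : ℝ) h1 hW
  have h4 := (hasDerivWithinAt_iff_tendsto_slope.1 h3).eventually (gt_mem_nhds hv)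
  have h5 : Ico 0 r \ {0} = Ioo 0 r := by
    ext t; simp only [mem_sdiff, mem_Ico, mem_singleton_iff, mem_Ioo]
    constructor
    · rintro ⟨⟨h, h'⟩, h''⟩; exact ⟨lt_of_le_of_ne h (Ne.symm h''), h'⟩
    · rintro ⟨h, h'⟩; exact ⟨⟨h.le, h'⟩, h.ne'⟩
  rw [h5, nhdsWithin_Ioo_eq_nhdsGT hr] at h4
  obtain ⟨d, hd, h6⟩ := (mem_nhdsGT_iff_exists_Ioo_subset).1 h4
  refine ⟨d, hd, fun t ht => ?_⟩
  have h7 := h6 ht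
  simp only [mem_ofPred_eq, slope, Function.comp, vsub_eq_sub, sub_zero, zero_smul, add_zero,
    smul_eq_mul] at h7
  have h8 : f (p + t • v) - f p < 0 := by
    by_contra hcon
    exact absurd h7 (not_lt.2 (mul_nonneg (inv_nonneg.2 ht.1.le) (not_lt.1 hcon)))
  linarith

/-! ### Lower bounds for the singular integrals -/

lemma inv_rpow_le_mul {x L t : ℝ≥0∞} {a : ℝ} (ha : 0 < a) (hL : L ≠ 0) (hx : x ≠ ∞)
    (h : x ≤ L * t) : (t ^ a)⁻¹ ≤ L ^ a * (x ^ a)⁻¹ := by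
  rcases eq_or_ne L ∞ with rfl | hL'
  · rw [ENNReal.top_rpow_of_pos ha, ENNReal.top_mul]
    · exact le_top
    · exact ENNReal.inv_ne_zero.2 (ENNReal.rpow_ne_top_of_nonneg ha.le hx)
  · have h1 : x ^ a ≤ L ^ a * t ^ a := by
      rw [← ENNReal.mul_rpow_of_nonneg _ _ ha.le]
      exact ENNReal.rpow_le_rpow h ha.le
    have hLa0 : L ^ a ≠ 0 := by simp [ENNReal.rpow_eq_zero_iff, hL, hL', ha.not_gt]
    have hLa : L ^ a ≠ ∞ := ENNReal.rpow_ne_top_of_nonneg ha.le hL'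
    have h2 := ENNReal.inv_le_inv.2 h1
    rw [ENNReal.mul_inv (Or.inl hLa0) (Or.inl hLa)] at h2
    calc (t ^ a)⁻¹ = L ^ a * ((L ^ a)⁻¹ * (t ^ a)⁻¹) := by
          rw [← mul_assoc, ENNReal.mul_inv_cancel hLa0 hLa, one_mul]
      _ ≤ _ := by gcongr

lemma ofReal_rpow_mul_rpow_inv {u v a b : ℝ} (hu : 0 ≤ u) (hv : 0 ≤ v) (ha : 0 ≤ a) (hb : 0 ≤ b) :
    (ENNReal.ofReal (u ^ a * v ^ b))⁻¹ =
      (ENNReal.ofReal u ^ a)⁻¹ * (ENNReal.ofReal v ^ b)⁻¹ := by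
  rw [ENNReal.ofReal_mul (by positivity), ENNReal.ofReal_rpow_of_nonneg hu ha,
    ENNReal.ofReal_rpow_of_nonneg hv hb,
    ENNReal.mul_inv (Or.inr ENNReal.ofReal_ne_top) (Or.inl ENNReal.ofReal_ne_top)]

lemma le_area_integrand {L L₀ L₁ : ℝ≥0∞} {u v w h b M α β : ℝ} (hα : 0 < α) (hβ : 0 < β)
    (hαβ : 2 < α + 2 * β) (hL : L ≠ 0) (hL₀ : L₀ ≠ 0) (hL₁ : L₁ ≠ 0)
    (hh : 0 < h) (hb : 0 < b) (hhM : h ≤ M) (hbM : b ≤ M)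
    (huh : ENNReal.ofReal |u| ≤ L * ENNReal.ofReal h)
    (hub : ENNReal.ofReal |u| ≤ L * ENNReal.ofReal b)
    (hv : ENNReal.ofReal |v| ≤ L₀ * ENNReal.ofReal h)
    (hw : ENNReal.ofReal |w| ≤ L₁ * ENNReal.ofReal b) :
    ENNReal.ofReal (M ^ (2 - α - 2 * β) * (h⁻¹ * b⁻¹)) ≤
      L ^ α * (L₀ ^ (2 * β) + L₁ ^ (2 * β)) *
        (ENNReal.ofReal (|u| ^ α * |v * w| ^ β))⁻¹ := by
  have hM : 0 < M := hh.trans_le hhM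
  -- the product of the two factors is at most the larger one squared
  have hLL : L₀ ^ β * L₁ ^ β ≤ L₀ ^ (2 * β) + L₁ ^ (2 * β) := by
    rw [mul_comm 2 β, ENNReal.rpow_mul, ENNReal.rpow_mul]
    norm_num
    rcases le_total (L₀ ^ β) (L₁ ^ β) with h | h
    · exact le_add_left ((mul_le_mul_left h _).trans_eq (sq _).symm)
    · exact le_add_right ((mul_le_mul_right h _).trans_eq (sq _).symm)
  have hum : ENNReal.ofReal |u| ≤ L * ENNReal.ofReal (min h b) := by
    rcases le_total h b with h' | h'
    · rwa [min_eq_left h']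
    · rwa [min_eq_right h']
  have h1 := inv_rpow_le_mul hα hL ENNReal.ofReal_ne_top hum
  have h2 := inv_rpow_le_mul hβ hL₀ ENNReal.ofReal_ne_top hv
  have h3 := inv_rpow_le_mul hβ hL₁ ENNReal.ofReal_ne_top hw
  have hmin : 0 < min h b := lt_min hh hb
  have key : M ^ (2 - α - 2 * β) * (h⁻¹ * b⁻¹) ≤ (min h b ^ α)⁻¹ * ((h ^ β)⁻¹ * (b ^ β)⁻¹) := by
    have hm : (min h b) ^ α * (h ^ β * b ^ β) ≤ h * b * M ^ (α + 2 * β - 2) := by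
      have e1 : h * b = min h b * max h b := (min_mul_max h b).symm
      have e2 : h ^ β * b ^ β = min h b ^ β * max h b ^ β := by
        rw [← Real.mul_rpow hh.le hb.le, e1, Real.mul_rpow hmin.le (by positivity)]
      have hmM : max h b ≤ M := max_le hhM hbM
      have hmm : min h b ≤ max h b := min_le_max
      rw [e1, e2]
      set m := min h b
      set N := max h b
      have hN : 0 < N := hmin.trans_le hmm
      have hpos : 0 < α + β - 1 := by linarith
      calc m ^ α * (m ^ β * N ^ β) = m ^ (α + β - 1) * m * N ^ β := by
            rw [← mul_assoc, ← Real.rpow_add hmin]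
            nth_rewrite 3 [← Real.rpow_one m]
            rw [← Real.rpow_add hmin]; ring_nf
        _ ≤ N ^ (α + β - 1) * m * N ^ β := by
            gcongr
        _ = m * N * N ^ (α + 2 * β - 2) := by
            have : N ^ (α + β - 1) * N ^ β = N * N ^ (α + 2 * β - 2) := by
              nth_rewrite 3 [← Real.rpow_one N]
              rw [← Real.rpow_add hN, ← Real.rpow_add hN]; ring_nf
            linear_combination m * this
        _ ≤ m * N * M ^ (α + 2 * β - 2) := by
            gcongr
    have e3 : M ^ (2 - α - 2 * β) = (M ^ (α + 2 * β - 2))⁻¹ := by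
      rw [← Real.rpow_neg hM.le]; ring_nf
    rw [e3, ← mul_inv, ← mul_inv, ← mul_inv, ← mul_inv]
    apply inv_anti₀ (by positivity)
    linarith
  rw [abs_mul, ofReal_rpow_mul_rpow_inv (abs_nonneg _) (by positivity) hα.le hβ.le,
    ENNReal.ofReal_mul (abs_nonneg _), ENNReal.mul_rpow_of_nonneg _ _ hβ.le,
    ENNReal.mul_inv (Or.inr (ENNReal.rpow_ne_top_of_nonneg hβ.le ENNReal.ofReal_ne_top))
      (Or.inl (ENNReal.rpow_ne_top_of_nonneg hβ.le ENNReal.ofReal_ne_top))]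
  calc _ ≤ ENNReal.ofReal ((min h b ^ α)⁻¹ * ((h ^ β)⁻¹ * (b ^ β)⁻¹)) :=
        ENNReal.ofReal_le_ofReal key
    _ = (ENNReal.ofReal (min h b) ^ α)⁻¹ *
          ((ENNReal.ofReal h ^ β)⁻¹ * (ENNReal.ofReal b ^ β)⁻¹) := by
        rw [ENNReal.ofReal_mul (by positivity), ENNReal.ofReal_mul (by positivity),
          ENNReal.ofReal_inv_of_pos (by positivity), ENNReal.ofReal_inv_of_pos (by positivity),
          ENNReal.ofReal_inv_of_pos (by positivity), ENNReal.ofReal_rpow_of_pos hmin,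
          ENNReal.ofReal_rpow_of_pos hh, ENNReal.ofReal_rpow_of_pos hb]
    _ ≤ (L ^ α * (ENNReal.ofReal |u| ^ α)⁻¹) * ((L₀ ^ β * (ENNReal.ofReal |v| ^ β)⁻¹) *
          (L₁ ^ β * (ENNReal.ofReal |w| ^ β)⁻¹)) := by gcongr
    _ = L ^ α * (L₀ ^ β * L₁ ^ β) * ((ENNReal.ofReal |u| ^ α)⁻¹ *
          ((ENNReal.ofReal |v| ^ β)⁻¹ * (ENNReal.ofReal |w| ^ β)⁻¹)) := by ring
    _ ≤ _ := by gcongr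

lemma IsC11On.continuousOn_partialOn {W : Set Plane} {f : Plane → ℝ} (hf : IsC11On f W)
    {i : Fin 2} : ContinuousOn (partialOn W f i) W :=
  hf.2.continuousOn.clm_apply continuousOn_const

/-- Weighting by the length `h` of a horizontal and `b` of a vertical section makes the area
integral scale invariant: the widths of the sections are compensated by the factor `h⁻¹ b⁻¹` in
the lower bound `le_area_integrand` for the integrand. -/
lemma le_area_integral {W A : Set Plane} {f : Plane → ℝ} {lam α β M κ b : ℝ} {Y : Set ℝ}
    (hα : 0 < α) (hβ : 0 < β) (hαβ : 2 < α + 2 * β) (hf : IsC11On f W)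
    (hA : MeasurableSet A) (hAW : A ⊆ W) (hY : MeasurableSet Y)
    (hκ : 0 ≤ κ) (hb : 0 < b) (hbM : b ≤ M) (hYb : ENNReal.ofReal (κ * b) ≤ volume Y)
    (hL : lipConst W f ≠ 0) (hL₀ : lipConst W (partialOn W f 0) ≠ 0)
    (hL₁ : lipConst W (partialOn W f 1) ≠ 0)
    (hsec : ∀ y ∈ Y, ∃ (h : ℝ) (T : Set ℝ), 0 < h ∧ h ≤ M ∧ MeasurableSet T ∧
      ENNReal.ofReal (κ * h) ≤ volume T ∧ ∀ x : Plane, x 0 ∈ T → x 1 = y → x ∈ A ∧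
        ENNReal.ofReal |f x - lam| ≤ lipConst W f * ENNReal.ofReal h ∧
        ENNReal.ofReal |f x - lam| ≤ lipConst W f * ENNReal.ofReal b ∧
        ENNReal.ofReal |partialOn W f 0 x| ≤
          lipConst W (partialOn W f 0) * ENNReal.ofReal h ∧
        ENNReal.ofReal |partialOn W f 1 x| ≤
          lipConst W (partialOn W f 1) * ENNReal.ofReal b) :
    ENNReal.ofReal (κ ^ 2 * M ^ (2 - α - 2 * β)) ≤
      lipConst W f ^ α *
        (lipConst W (partialOn W f 0) ^ (2 * β) + lipConst W (partialOn W f 1) ^ (2 * β)) *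
        ∫⁻ x in A, (ENNReal.ofReal
          (|f x - lam| ^ α * |partialOn W f 0 x * partialOn W f 1 x| ^ β))⁻¹ := by
  set L := lipConst W f ^ α *
    (lipConst W (partialOn W f 0) ^ (2 * β) + lipConst W (partialOn W f 1) ^ (2 * β)) with hLdef
  set g : Plane → ℝ≥0∞ := fun x => (ENNReal.ofReal
          (|f x - lam| ^ α * |partialOn W f 0 x * partialOn W f 1 x| ^ β))⁻¹ with hg
  have hM : 0 < M := hb.trans_le hbM
  have hgm : AEMeasurable g (volume.restrict A) := by
    have hp : ∀ i, AEMeasurable (partialOn W f i) (volume.restrict A) := fun i =>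
      (hf.continuousOn_partialOn.mono hAW).aemeasurable hA
    have hf' : AEMeasurable f (volume.restrict A) :=
      ((hf.1.continuousOn).mono hAW).aemeasurable hA
    refine (((hf'.sub_const lam).norm.pow_const α).mul
      (((hp 0).mul (hp 1)).norm.pow_const β)).ennreal_ofReal.inv
  let e : Plane ≃ᵐ ℝ × ℝ := (MeasurableEquiv.toLp 2 (Fin 2 → ℝ)).symm.trans
    (MeasurableEquiv.finTwoArrow (α := ℝ))
  have he : MeasurePreserving e volume volume :=
    (volume_preserving_finTwoArrow ℝ).comp
      (EuclideanSpace.volume_preserving_symm_measurableEquiv_toLp (Fin 2))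
  have hind : L * ∫⁻ x in A, g x = ∫⁻ z : ℝ × ℝ, A.indicator (fun x => L * g x) (e.symm z) := by
    rw [← lintegral_const_mul'' _ hgm, ← lintegral_indicator hA]
    exact ((he.symm e).lintegral_comp_emb e.symm.measurableEmbedding _).symm
  have hgm' : AEMeasurable (fun z : ℝ × ℝ => A.indicator (fun x => L * g x) (e.symm z)) volume := by
    have h1 : AEMeasurable (A.indicator fun x => L * g x) volume :=
      (aemeasurable_indicator_iff hA).2 (hgm.const_mul L)
    exact h1.comp_quasiMeasurePreserving (he.symm e).quasiMeasurePreserving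
  rw [hind, show (volume : Measure (ℝ × ℝ)) = (volume : Measure ℝ).prod volume from rfl,
    lintegral_prod_symm _ hgm']
  have hrow : ∀ y ∈ Y, ENNReal.ofReal (κ * M ^ (2 - α - 2 * β) * b⁻¹) ≤
      ∫⁻ x, A.indicator (fun x => L * g x) (e.symm (x, y)) := by
    intro y hy
    obtain ⟨h, T, hh, hhM, hT, hTh, hx⟩ := hsec y hy
    calc ENNReal.ofReal (κ * M ^ (2 - α - 2 * β) * b⁻¹)
        = ENNReal.ofReal (M ^ (2 - α - 2 * β) * (h⁻¹ * b⁻¹)) * ENNReal.ofReal (κ * h) := by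
          rw [← ENNReal.ofReal_mul (by positivity)]
          congr 1; field_simp
      _ ≤ ENNReal.ofReal (M ^ (2 - α - 2 * β) * (h⁻¹ * b⁻¹)) * volume T := by gcongr
      _ = ∫⁻ x in T, ENNReal.ofReal (M ^ (2 - α - 2 * β) * (h⁻¹ * b⁻¹)) := by
          rw [setLIntegral_const]
      _ ≤ ∫⁻ x in T, A.indicator (fun x => L * g x) (e.symm (x, y)) := by
          refine setLIntegral_mono' hT fun x hxT => ?_
          obtain ⟨hxA, h1, h2, h3, h4⟩ := hx (e.symm (x, y)) hxT rfl
          rw [indicator_of_mem hxA]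
          exact le_area_integrand hα hβ hαβ hL hL₀ hL₁ hh hb hhM hbM h1 h2 h3 h4
      _ ≤ ∫⁻ x, A.indicator (fun x => L * g x) (e.symm (x, y)) := setLIntegral_le_lintegral _ _
  calc ENNReal.ofReal (κ ^ 2 * M ^ (2 - α - 2 * β))
      = ENNReal.ofReal (κ * M ^ (2 - α - 2 * β) * b⁻¹) * ENNReal.ofReal (κ * b) := by
        rw [← ENNReal.ofReal_mul (by positivity)]
        congr 1; field_simp
    _ ≤ ENNReal.ofReal (κ * M ^ (2 - α - 2 * β) * b⁻¹) * volume Y := by gcongr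
    _ = ∫⁻ y in Y, ENNReal.ofReal (κ * M ^ (2 - α - 2 * β) * b⁻¹) := by rw [setLIntegral_const]
    _ ≤ ∫⁻ y in Y, ∫⁻ x, A.indicator (fun x => L * g x) (e.symm (x, y)) :=
        setLIntegral_mono' hY hrow
    _ ≤ _ := setLIntegral_le_lintegral _ _

lemma le_edge_integral {W S : Set Plane} {f : Plane → ℝ} {lam α β M κ s : ℝ} {j : Fin 2}
    (hα : 0 < α) (hβ : 0 < β) (hαβ : 1 < α + β) (hf : IsC11On f W)
    (hS : MeasurableSet S) (hSW : S ⊆ W)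
    (hκ : 0 ≤ κ) (hs : 0 < s) (hsM : s ≤ M)
    (hSs : ENNReal.ofReal (κ * s) ≤ Measure.hausdorffMeasure 1 S)
    (hL : lipConst W f ≠ 0) (hLj : lipConst W (partialOn W f j) ≠ 0)
    (hb : ∀ x ∈ S, ENNReal.ofReal |f x - lam| ≤ lipConst W f * ENNReal.ofReal s ∧
      ENNReal.ofReal |partialOn W f j x| ≤ lipConst W (partialOn W f j) * ENNReal.ofReal s) :
    ENNReal.ofReal (κ * M ^ (1 - α - β)) ≤
      lipConst W f ^ α * (lipConst W (partialOn W f j) ^ β *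
        ∫⁻ x in S, (ENNReal.ofReal (|f x - lam| ^ α * |partialOn W f j x| ^ β))⁻¹
          ∂(Measure.hausdorffMeasure 1)) := by
  have hM : 0 < M := hs.trans_le hsM
  set L := lipConst W f ^ α * lipConst W (partialOn W f j) ^ β
  have hpt : ∀ x ∈ S, ENNReal.ofReal (s ^ (-α - β)) ≤
      L * (ENNReal.ofReal (|f x - lam| ^ α * |partialOn W f j x| ^ β))⁻¹ := by
    intro x hx
    have h1 := inv_rpow_le_mul hα hL ENNReal.ofReal_ne_top (hb x hx).1
    have h2 := inv_rpow_le_mul hβ hLj ENNReal.ofReal_ne_top (hb x hx).2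
    have e : s ^ (-α - β) = (s ^ α)⁻¹ * (s ^ β)⁻¹ := by
      rw [← Real.rpow_neg hs.le, ← Real.rpow_neg hs.le, ← Real.rpow_add hs]; ring_nf
    rw [ofReal_rpow_mul_rpow_inv (abs_nonneg _) (abs_nonneg _) hα.le hβ.le, e,
      ENNReal.ofReal_mul (by positivity), ENNReal.ofReal_inv_of_pos (by positivity),
      ENNReal.ofReal_inv_of_pos (by positivity), ← ENNReal.ofReal_rpow_of_pos hs,
      ← ENNReal.ofReal_rpow_of_pos hs]
    calc _ ≤ _ := mul_le_mul' h1 h2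
      _ = _ := by ring
  have hI : ENNReal.ofReal (κ * s ^ (1 - α - β)) ≤
      L * ∫⁻ x in S, (ENNReal.ofReal (|f x - lam| ^ α * |partialOn W f j x| ^ β))⁻¹
          ∂(Measure.hausdorffMeasure 1) := by
    have hgm : AEMeasurable (fun x => (ENNReal.ofReal
        (|f x - lam| ^ α * |partialOn W f j x| ^ β))⁻¹)
        ((Measure.hausdorffMeasure 1).restrict S) :=
      ((((hf.1.continuousOn.mono hSW).aemeasurable hS).sub_const lam).norm.pow_const α
        |>.mul ((hf.continuousOn_partialOn.mono hSW).aemeasurable hS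
          |>.norm.pow_const β)).ennreal_ofReal.inv
    calc ENNReal.ofReal (κ * s ^ (1 - α - β))
        = ENNReal.ofReal (s ^ (-α - β)) * ENNReal.ofReal (κ * s) := by
          rw [← ENNReal.ofReal_mul (by positivity)]
          congr 1
          rw [show 1 - α - β = (-α - β) + 1 by ring, Real.rpow_add_one hs.ne']
          ring
      _ ≤ ENNReal.ofReal (s ^ (-α - β)) * Measure.hausdorffMeasure 1 S := by gcongr
      _ = ∫⁻ x in S, ENNReal.ofReal (s ^ (-α - β)) ∂(Measure.hausdorffMeasure 1) := by
          rw [setLIntegral_const]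
      _ ≤ _ := setLIntegral_mono' hS hpt
      _ = _ := lintegral_const_mul'' _ hgm
  rw [← mul_assoc]
  refine le_trans (ENNReal.ofReal_le_ofReal ?_) hI
  exact mul_le_mul_of_nonneg_left (Real.rpow_le_rpow_of_nonpos hs hsM (by linarith)) hκ

/-- Counting by disjoint contributions: if each member of a family has its own part of `X`, all
parts being disjoint, and each part carries at least `c`, then the family has at most
`K * ∫ g / c` members. -/
lemma encard_mul_le_of_disjoint {X : Type*} [MeasurableSpace X] {μ : Measure X} {ι : Type*}
    {𝒞 : Set ι} {R : ι → Set X} {E : Set X} {g : X → ℝ≥0∞} {c K : ℝ≥0∞}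
    (hd : 𝒞.PairwiseDisjoint R) (hm : ∀ Q ∈ 𝒞, MeasurableSet (R Q)) (hE : ∀ Q ∈ 𝒞, R Q ⊆ E)
    (hc : ∀ Q ∈ 𝒞, c ≤ K * ∫⁻ x in R Q, g x ∂μ) :
    (𝒞.encard : ℝ≥0∞) * c ≤ K * ∫⁻ x in E, g x ∂μ := by
  have hfin : ∀ t : Finset ι, (t : Set ι) ⊆ 𝒞 → (t.card : ℝ≥0∞) * c ≤ K * ∫⁻ x in E, g x ∂μ := by
    intro t ht
    calc (t.card : ℝ≥0∞) * c = ∑ Q ∈ t, c := by rw [Finset.sum_const, nsmul_eq_mul]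
      _ ≤ ∑ Q ∈ t, K * ∫⁻ x in R Q, g x ∂μ := Finset.sum_le_sum fun Q hQ => hc Q (ht hQ)
      _ = K * ∫⁻ x in ⋃ Q ∈ t, R Q, g x ∂μ := by
          rw [← Finset.mul_sum, lintegral_biUnion_finset (hd.subset ht) fun Q hQ => hm Q (ht hQ)]
      _ ≤ _ := by
          gcongr
          exact iUnion₂_subset fun Q hQ => hE Q (ht hQ)
  rcases 𝒞.finite_or_infinite with h | h
  · have := hfin h.toFinset (by simp)
    rwa [h.encard_eq_coe_toFinset_card]
  · rcases eq_or_ne c 0 with rfl | hc0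
    · simp
    · have htop : K * ∫⁻ x in E, g x ∂μ = ∞ := by
        by_contra hne
        obtain ⟨n, hn⟩ := ENNReal.exists_nat_mul_gt hc0 hne
        obtain ⟨t, ht, hcard⟩ := h.exists_subset_card_eq n
        have := hfin t ht
        rw [hcard] at this
        exact absurd hn (not_lt.2 this)
      rw [htop]; exact le_top

/-! ### Length of segments parallel to an axis -/

lemma isometry_add_smul_axis (x : Plane) (j : Fin 2) :
    Isometry (fun t : ℝ => x + t • axis j) :=
  Isometry.of_dist_eq fun s t => by rw [dist_add_smul_axis, Real.dist_eq]

lemma hausdorffMeasure_image_axis (x : Plane) (j : Fin 2) (T : Set ℝ) :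
    Measure.hausdorffMeasure 1 ((fun t : ℝ => x + t • axis j) '' T) = volume T := by
  rw [(isometry_add_smul_axis x j).hausdorffMeasure_image (Or.inl zero_le_one),
    hausdorffMeasure_real]

lemma measurableSet_image_axis (x : Plane) (j : Fin 2) {T : Set ℝ} (hT : MeasurableSet T) :
    MeasurableSet ((fun t : ℝ => x + t • axis j) '' T) :=
  (isometry_add_smul_axis x j).isClosedEmbedding.measurableEmbedding.measurableSet_image.2 hT

/-! ### Sublevel sets and their components -/

/-- What sublevel sets `{f ≤ lam}` and strict sublevel sets `{f < lam}` of `f : W → ℝ` have in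
common. -/
structure IsSublevelSet (W : Set Plane) (f : Plane → ℝ) (lam : ℝ) (F : Set Plane) : Prop where
  subset : F ⊆ W
  mem_of_lt : ∀ x ∈ W, f x < lam → x ∈ F
  le : ∀ x ∈ F, f x ≤ lam
  lt_of_notMem : ∀ x ∈ F, ∀ y ∈ W, y ∉ F → f x < f y

lemma isSublevelSet_of_eq {W F : Set Plane} {f : Plane → ℝ} {lam : ℝ}
    (h : F = sublevel W f lam ∨ F = strictSublevel W f lam) : IsSublevelSet W f lam F := by
  rcases h with rfl | rfl
  · exact ⟨fun x hx => hx.1, fun x hx h => ⟨hx, h.le⟩, fun x hx => hx.2,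
      fun x hx y hy hyF => lt_of_le_of_lt hx.2 (not_le.1 fun h => hyF ⟨hy, h⟩)⟩
  · exact ⟨fun x hx => hx.1, fun x hx h => ⟨hx, h⟩, fun x hx => hx.2.le,
      fun x hx y hy hyF => lt_of_lt_of_le hx.2 (not_lt.1 fun h => hyF ⟨hy, h⟩)⟩

lemma subset_component_of_isPreconnected {F S : Set Plane} {x y : Plane}
    (hS : IsPreconnected S) (hSF : S ⊆ F) (hy : y ∈ S) (hyK : y ∈ connectedComponentIn F x) :
    S ⊆ connectedComponentIn F x := by
  rw [connectedComponentIn_eq hyK]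
  exact hS.subset_connectedComponentIn hy hSF

lemma mem_component_of_mem_closure {F : Set Plane} {x y : Plane} (hx : x ∈ F)
    (hy : y ∈ closure (connectedComponentIn F x)) (hyF : y ∈ F) :
    y ∈ connectedComponentIn F x := by
  have h1 : IsPreconnected (insert y (connectedComponentIn F x)) :=
    isPreconnected_connectedComponentIn.subset_closure (subset_insert _ _)
      (insert_subset hy subset_closure)
  exact subset_component_of_isPreconnected h1
    (insert_subset hyF (connectedComponentIn_subset F x))
    (mem_insert_of_mem _ (mem_connectedComponentIn hx)) (mem_connectedComponentIn hx)
    (mem_insert _ _)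

lemma add_smul_mem_component {F : Set Plane} {x p v : Plane} {a b : ℝ}
    (h : ∀ t ∈ Icc a b, p + t • v ∈ F) {t₀ : ℝ} (ht₀ : t₀ ∈ Icc a b) (h₀ : p + t₀ • v ∈ connectedComponentIn F x) :
    ∀ t ∈ Icc a b, p + t • v ∈ connectedComponentIn F x := by
  have hc : IsPreconnected ((fun t : ℝ => p + t • v) '' Icc a b) :=
    isPreconnected_Icc.image _ (by fun_prop)
  intro t ht
  exact subset_component_of_isPreconnected hc (by rintro _ ⟨t, ht, rfl⟩; exact h t ht)
    (mem_image_of_mem _ ht₀) h₀ (mem_image_of_mem _ ht)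

namespace IsSublevelSet

variable {W F : Set Plane} {f : Plane → ℝ} {lam : ℝ}

lemma le_of_notMem (h : IsSublevelSet W f lam F) {y : Plane} (hy : y ∈ W) (hyF : y ∉ F) :
    lam ≤ f y := not_lt.1 fun h' => hyF (h.mem_of_lt y hy h')

lemma mem_of_le (h : IsSublevelSet W f lam F) {x y : Plane} (hx : x ∈ F) (hxl : f x = lam)
    (hy : y ∈ W) (hyl : f y ≤ lam) : y ∈ F := by
  by_contra hyF
  have := h.lt_of_notMem x hx y hy hyF
  linarith

lemma le_of_mem_closure (h : IsSublevelSet W f lam F) (hW : IsClosed W) (hf : ContinuousOn f W)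
    {y : Plane} (hy : y ∈ closure F) : y ∈ W ∧ f y ≤ lam := by
  have hyW : y ∈ W := closure_minimal h.subset hW hy
  refine ⟨hyW, ?_⟩
  have h1 : IsClosed (W ∩ f ⁻¹' Iic lam) := hf.preimage_isClosed_of_isClosed hW isClosed_Iic
  exact (closure_minimal (fun z hz => ⟨h.subset hz, h.le z hz⟩ : F ⊆ W ∩ f ⁻¹' Iic lam) h1 hy).2

lemma mem_interior_component (h : IsSublevelSet W f lam F) (hf : ContinuousOn f W) {x p : Plane}
    (hp : p ∈ connectedComponentIn F x) (hpW : p ∈ interior W) (hpl : f p < lam) :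
    p ∈ interior (connectedComponentIn F x) := by
  have h1 : IsOpen (interior W ∩ f ⁻¹' Iio lam) :=
    (hf.mono interior_subset).isOpen_inter_preimage isOpen_interior isOpen_Iio
  obtain ⟨r, hr, hB⟩ := Metric.isOpen_iff.1 h1 p ⟨hpW, hpl⟩
  rw [mem_interior_iff_mem_nhds]
  refine Filter.mem_of_superset (Metric.ball_mem_nhds p hr) ?_
  exact subset_component_of_isPreconnected (convex_ball p r).isPreconnected
    (fun z hz => h.mem_of_lt z (interior_subset (hB hz).1) (hB hz).2)
    (Metric.mem_ball_self hr) hp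

end IsSublevelSet

/-! ### Maximal segments -/

lemma exists_exit {U : Set ℝ} {B : ℝ} (h0 : 0 ∈ U)
    (hU : ∀ t, 0 ≤ t → Icc 0 t ⊆ U → ∃ d, 0 < d ∧ Icc t (t + d) ⊆ U)
    (hB : ∀ t ∈ U, t ≤ B) : ∃ b, 0 < b ∧ Ico 0 b ⊆ U ∧ b ∉ U := by
  set N := {t : ℝ | 0 ≤ t ∧ t ∉ U}
  have hN : N.Nonempty := ⟨max 0 (B + 1), le_max_left _ _, fun h => by
    have := hB _ h
    linarith [le_max_right 0 (B + 1)]⟩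
  have hbdd : BddBelow N := ⟨0, fun t ht => ht.1⟩
  have hb0 : 0 ≤ sInf N := le_csInf hN fun t ht => ht.1
  have hlt : Ico 0 (sInf N) ⊆ U := by
    intro t ht
    by_contra htU
    exact absurd (csInf_le hbdd ⟨ht.1, htU⟩) (not_le.2 ht.2)
  have hnot : sInf N ∉ U := by
    intro hmem
    have hIcc : Icc 0 (sInf N) ⊆ U := by
      intro t ht
      rcases eq_or_lt_of_le ht.2 with rfl | h
      · exact hmem
      · exact hlt ⟨ht.1, h⟩
    obtain ⟨d, hd, hsub⟩ := hU _ hb0 hIcc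
    have : sInf N + d ≤ sInf N := by
      refine le_csInf hN fun t ht => ?_
      by_contra! hcon
      rcases le_total t (sInf N) with h | h
      · exact ht.2 (hIcc ⟨ht.1, h⟩)
      · exact ht.2 (hsub ⟨h, hcon.le⟩)
    linarith
  refine ⟨sInf N, lt_of_le_of_ne hb0 ?_, hlt, hnot⟩
  intro h
  exact hnot (h ▸ h0)

lemma exists_maximal_Ioo {U : Set ℝ} {B : ℝ} (h0 : 0 ∈ U)
    (hR : ∀ t, 0 ≤ t → Icc 0 t ⊆ U → ∃ d, 0 < d ∧ Icc t (t + d) ⊆ U)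
    (hL : ∀ t, t ≤ 0 → Icc t 0 ⊆ U → ∃ d, 0 < d ∧ Icc (t - d) t ⊆ U)
    (hB : ∀ t ∈ U, |t| ≤ B) : ∃ a b, a < 0 ∧ 0 < b ∧ Ioo a b ⊆ U ∧ a ∉ U ∧ b ∉ U := by
  obtain ⟨b, hb, hbU, hbn⟩ := exists_exit h0 hR fun t ht => (abs_le.1 (hB t ht)).2
  obtain ⟨a, ha, haU, han⟩ := exists_exit (U := {t | -t ∈ U}) (B := B) (by simpa using h0)
    (fun t ht hsub => by
      obtain ⟨d, hd, h⟩ := hL (-t) (by linarith) fun s hs => by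
        have := @hsub (-s) ⟨by linarith [hs.2], by linarith [hs.1]⟩
        rwa [mem_ofPred_eq, neg_neg] at this
      exact ⟨d, hd, fun s hs => h ⟨by linarith [hs.2], by linarith [hs.1]⟩⟩)
    fun t ht => by linarith [(abs_le.1 (hB _ ht)).1]
  refine ⟨-a, b, by linarith, hb, fun t ht => ?_, han, hbn⟩
  rcases le_total 0 t with h | h
  · exact hbU ⟨h, ht.2⟩
  · have := @haU (-t) ⟨by linarith, by linarith [ht.1]⟩
    rwa [mem_ofPred_eq, neg_neg] at this

/-- A maximal open segment of a set on which `f < lam`, such that `f` is at least `lam` at the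
limit points missing from the set, is a well. -/
lemma exists_isWell_section {W V : Set Plane} {f : Plane → ℝ} {lam B : ℝ} {j : Fin 2} {x : Plane}
    (hx : x ∈ V) (hVW : closure V ⊆ W) (hlt : ∀ y ∈ V, f y < lam)
    (hcl : ∀ y ∈ closure V, y ∉ V → lam ≤ f y)
    (hB : ∀ t : ℝ, x + t • axis j ∈ V → |t| ≤ B)
    (hR : ∀ t : ℝ, 0 ≤ t → (∀ s ∈ Icc 0 t, x + s • axis j ∈ V) →
      ∃ d, 0 < d ∧ ∀ s ∈ Icc t (t + d), x + s • axis j ∈ V)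
    (hL : ∀ t : ℝ, t ≤ 0 → (∀ s ∈ Icc t 0, x + s • axis j ∈ V) →
      ∃ d, 0 < d ∧ ∀ s ∈ Icc (t - d) t, x + s • axis j ∈ V) :
    ∃ a b, a < b ∧ IsWell W f lam j x a b ∧ (0 : ℝ) ∈ Ioo a b ∧
      (∀ t ∈ Ioo a b, x + t • axis j ∈ V) ∧ ∀ t ∈ Icc a b, x + t • axis j ∈ closure V := by
  obtain ⟨a, b, ha, hb, hsub, han, hbn⟩ := exists_maximal_Ioo
    (U := {t : ℝ | x + t • axis j ∈ V}) (by simpa using hx) hR hL hB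
  have hcont : Continuous fun t : ℝ => x + t • axis j := by fun_prop
  have hIcc : ∀ t ∈ Icc a b, x + t • axis j ∈ closure V := by
    intro t ht
    rw [← closure_Ioo (ha.trans hb).ne] at ht
    exact map_mem_closure (f := fun t : ℝ => x + t • axis j) hcont ht hsub
  have hab := ha.trans hb
  have hla := hcl _ (hIcc a ⟨le_rfl, hab.le⟩) han
  have hlb := hcl _ (hIcc b ⟨hab.le, le_rfl⟩) hbn
  exact ⟨a, b, hab, ⟨ha.le, hb.le, fun t ht => hVW (hIcc t ht), (hlt x hx).le, hla, hlb,
    (hlt x hx).trans_le hla, (hlt x hx).trans_le hlb⟩, ⟨ha, hb⟩, hsub, hIcc⟩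

lemma abs_le_of_add_smul_axis_mem {V : Set Plane} (hV : Bornology.IsBounded V) {x : Plane}
    (hx : x ∈ V) {j : Fin 2} {t : ℝ} (ht : x + t • axis j ∈ V) : |t| ≤ Metric.diam V := by
  have h := Metric.dist_le_diam_of_mem hV ht hx
  have h2 := dist_add_smul_axis x t 0 j
  simp only [zero_smul, add_zero, sub_zero] at h2
  rwa [h2] at h

lemma sub_le_diam {V : Set Plane} (hV : Bornology.IsBounded V) {x : Plane} {j : Fin 2} {a b : ℝ}
    (hab : a ≤ b) (h : ∀ t ∈ Icc a b, x + t • axis j ∈ closure V) : b - a ≤ Metric.diam V := by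
  have h1 := Metric.dist_le_diam_of_mem hV.closure (h b ⟨hab, le_rfl⟩) (h a ⟨le_rfl, hab⟩)
  rw [dist_add_smul_axis, Metric.diam_closure] at h1
  exact (le_abs_self _).trans h1

/-- The maximal segments of an open set extend on both sides until they leave it. -/
lemma exists_isWell_of_isOpen {W V : Set Plane} {f : Plane → ℝ} {lam : ℝ} (j : Fin 2) {x : Plane}
    (hx : x ∈ V) (hVW : closure V ⊆ W) (hlt : ∀ y ∈ V, f y < lam)
    (hcl : ∀ y ∈ closure V, y ∉ V → lam ≤ f y) (hVo : IsOpen V) (hVb : Bornology.IsBounded V) :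
    ∃ a b, a < b ∧ IsWell W f lam j x a b ∧ (0 : ℝ) ∈ Ioo a b ∧
      (∀ t ∈ Ioo a b, x + t • axis j ∈ V) ∧ b - a ≤ Metric.diam V := by
  have ho : IsOpen {t : ℝ | x + t • axis j ∈ V} := hVo.preimage (by fun_prop)
  have hnear : ∀ t : ℝ, x + t • axis j ∈ V → ∃ d, 0 < d ∧ ∀ s ∈ Icc (t - d) (t + d),
      x + s • axis j ∈ V := by
    intro t ht
    obtain ⟨d, hd, h⟩ := Metric.isOpen_iff.1 ho t ht
    refine ⟨d / 2, by positivity, fun s hs => h ?_⟩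
    rw [Metric.mem_ball, Real.dist_eq, abs_lt]
    constructor <;> linarith [hs.1, hs.2]
  obtain ⟨a, b, hab, h1, h2, h3, h4⟩ := exists_isWell_section hx hVW hlt hcl
    (fun t ht => abs_le_of_add_smul_axis_mem hVb hx ht)
    (fun t ht h => by
      obtain ⟨d, hd, h'⟩ := hnear t (h t ⟨ht, le_rfl⟩)
      exact ⟨d, hd, fun s hs => h' s ⟨by linarith [hs.1], hs.2⟩⟩)
    (fun t ht h => by
      obtain ⟨d, hd, h'⟩ := hnear t (h t ⟨le_rfl, ht⟩)
      exact ⟨d, hd, fun s hs => h' s ⟨hs.1, by linarith [hs.2]⟩⟩)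
  exact ⟨a, b, hab, h1, h2, h3, sub_le_diam hVb hab.le h4⟩

/-! ### Components away from the boundary of `W` -/

lemma exists_eq_add_smul_axis {x y : Plane} (h : y 1 = x 1) : y = x + (y 0 - x 0) • axis 0 := by
  ext i
  fin_cases i
  · simp [axis]
  · simp [axis, h]

namespace IsSublevelSet

variable {W F : Set Plane} {f : Plane → ℝ} {lam : ℝ}

/-- A component in the interior of `W` has interior points with `f < lam`: otherwise `f = lam`
on it, and one could go down along `-∇f` from a frontier point. -/
lemma exists_mem_interior_component (h : IsSublevelSet W f lam F) (hW : IsClosed W)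
    (hf : DifferentiableOn ℝ f W)
    (hgrad : ∀ x ∈ relFrontier W F, fderivWithin ℝ f W x ≠ 0) (hFb : Bornology.IsBounded F)
    {x : Plane} (hx : x ∈ F) (hK : ∀ p ∈ connectedComponentIn F x, p ∉ frontier W) :
    ∃ p ∈ interior (connectedComponentIn F x), f p < lam := by
  set K := connectedComponentIn F x with hKdef
  have hKF : K ⊆ F := connectedComponentIn_subset F x
  have hint : ∀ p ∈ K, p ∈ interior W := by
    intro p hp
    by_contra hpi
    exact hK p hp ⟨subset_closure (h.subset (hKF hp)), hpi⟩
  by_cases hex : ∃ p ∈ K, f p < lam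
  · obtain ⟨p, hp, hpl⟩ := hex
    exact ⟨p, h.mem_interior_component hf.continuousOn hp (hint p hp) hpl, hpl⟩
  exfalso
  push Not at hex
  have hval : ∀ p ∈ K, f p = lam := fun p hp => le_antisymm (h.le p (hKF hp)) (hex p hp)
  have hxK : x ∈ K := mem_connectedComponentIn hx
  have hne : (frontier K).Nonempty := by
    refine nonempty_frontier_iff.2 ⟨⟨x, hxK⟩, ?_⟩
    intro huniv
    exact NormedSpace.unbounded_univ ℝ Plane (huniv ▸ hFb.subset hKF)
  obtain ⟨p, hp⟩ := hne
  obtain ⟨hpW, hpl⟩ := h.le_of_mem_closure hW hf.continuousOn (closure_mono hKF hp.1)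
  have hpF : p ∈ F := h.mem_of_le hx (hval x hxK) hpW hpl
  have hpK : p ∈ K := mem_component_of_mem_closure hx hp.1 hpF
  have hpi := hint p hpK
  have hcl : p ∈ closure (W \ F) := by
    rw [Metric.mem_closure_iff]
    intro e he
    obtain ⟨r, hr, hB⟩ := Metric.isOpen_iff.1 isOpen_interior p hpi
    by_contra! hcon
    apply hp.2
    rw [mem_interior_iff_mem_nhds]
    refine Filter.mem_of_superset (Metric.ball_mem_nhds p (lt_min hr he)) ?_
    refine subset_component_of_isPreconnected (convex_ball p _).isPreconnected ?_
      (Metric.mem_ball_self (lt_min hr he)) hpK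
    intro z hz
    by_contra hzF
    have h1 : z ∈ W := interior_subset (hB (Metric.ball_subset_ball (min_le_left _ _) hz))
    have h2 := hcon z ⟨h1, hzF⟩
    rw [Metric.mem_ball, dist_comm] at hz
    exact absurd (hz.trans_le (min_le_right _ _)) (not_lt.2 h2)
  have hg := hgrad p ⟨⟨hpW, subset_closure hpF⟩, hcl⟩
  obtain ⟨v, hv⟩ : ∃ v, fderivWithin ℝ f W p v < 0 := by
    by_contra! hcon
    apply hg
    ext v
    refine le_antisymm ?_ (hcon v)
    have := hcon (-v)
    rw [map_neg] at this
    simpa using this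
  have ho : IsOpen {t : ℝ | p + t • v ∈ interior W} := isOpen_interior.preimage (by fun_prop)
  obtain ⟨r, hr, hB⟩ := Metric.isOpen_iff.1 ho 0 (by simpa using hpi)
  have hB' : ∀ t ∈ Ico 0 r, p + t • v ∈ W := fun t ht => interior_subset (hB (by
    rw [Metric.mem_ball, Real.dist_eq, sub_zero, abs_of_nonneg ht.1]; exact ht.2))
  obtain ⟨d, hd, hlt⟩ := eventually_lt_of_fderivWithin_neg hf hpW hv hr hB'
  have hlam : f p = lam := hval p hpK
  have hm : 0 < min d r := lt_min hd hr
  have hmem : ∀ t ∈ Icc 0 (min d r / 2), p + t • v ∈ F := by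
    intro t ht
    rcases eq_or_lt_of_le ht.1 with rfl | h0
    · simpa using hpF
    · have h1 : t < d := by linarith [ht.2, min_le_left d r]
      have h2 : t < r := by linarith [ht.2, min_le_right d r]
      exact h.mem_of_lt _ (hB' t ⟨h0.le, h2⟩) (hlam ▸ hlt t ⟨h0, h1⟩)
  have h2 := add_smul_mem_component hmem (t₀ := 0) ⟨le_rfl, by positivity⟩
    (by simpa using hpK) (min d r / 2) ⟨by positivity, le_rfl⟩
  have h3 := hlt (min d r / 2) ⟨by positivity, by linarith [min_le_left d r]⟩
  exact absurd (hval _ h2) (by rw [← hlam]; exact h3.ne)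

/-- The part of the interior of a component where `f < lam` is open, with `f = lam` on its
frontier, so each of its horizontal and vertical sections consists of wells. -/
lemma le_area_integral_component {α β M : ℝ} (h : IsSublevelSet W f lam F) (hW : IsClosed W)
    (hf : IsC11On f W) (hgrad : ∀ x ∈ relFrontier W F, fderivWithin ℝ f W x ≠ 0)
    (hFb : Bornology.IsBounded F) (hα : 0 < α) (hβ : 0 < β) (hαβ : 2 < α + 2 * β)
    (hM : 2 * Metric.diam F ≤ M)
    {x : Plane} (hx : x ∈ F) (hK : ∀ p ∈ connectedComponentIn F x, p ∉ frontier W) :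
    MeasurableSet (interior (connectedComponentIn F x) ∩ f ⁻¹' Iio lam) ∧
    ENNReal.ofReal ((1 / 4) ^ 2 * M ^ (2 - α - 2 * β)) ≤
      lipConst W f ^ α *
        (lipConst W (partialOn W f 0) ^ (2 * β) + lipConst W (partialOn W f 1) ^ (2 * β)) *
        ∫⁻ x in interior (connectedComponentIn F x) ∩ f ⁻¹' Iio lam, (ENNReal.ofReal
          (|f x - lam| ^ α * |partialOn W f 0 x * partialOn W f 1 x| ^ β))⁻¹ := by
  have hcont := hf.1.continuousOn
  set K := connectedComponentIn F x with hKdef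
  set V := interior K ∩ f ⁻¹' Iio lam with hVdef
  have hKF : K ⊆ F := connectedComponentIn_subset F x
  have hVF : V ⊆ F := fun z hz => hKF (interior_subset hz.1)
  have hVb : Bornology.IsBounded V := hFb.subset hVF
  have hVo : IsOpen V :=
    (hcont.mono (interior_subset.trans (hKF.trans h.subset))).isOpen_inter_preimage
      isOpen_interior isOpen_Iio
  have hVW : closure V ⊆ W := closure_minimal (hVF.trans h.subset) hW
  have hlt : ∀ y ∈ V, f y < lam := fun y hy => hy.2
  have hcl : ∀ y ∈ closure V, y ∉ V → lam ≤ f y := by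
    intro y hy hyV
    by_contra! hcon
    have hyF := h.mem_of_lt y (hVW hy) hcon
    have hyK : y ∈ K := mem_component_of_mem_closure hx
      (closure_mono (fun z hz => interior_subset hz.1) hy) hyF
    have hyi : y ∈ interior W := by
      by_contra hpi
      exact hK y hyK ⟨subset_closure (h.subset hyF), hpi⟩
    exact hyV ⟨h.mem_interior_component hcont hyK hyi hcon, hcon⟩
  have hD : Metric.diam V ≤ Metric.diam F := Metric.diam_mono hVF hFb
  refine ⟨hVo.measurableSet, ?_⟩
  obtain ⟨p, hp, hpl⟩ := h.exists_mem_interior_component hW hf.1 hgrad hFb hx hK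
  have hpV : p ∈ V := ⟨hp, hpl⟩
  have hwell := fun j {x} (hx : x ∈ V) => exists_isWell_of_isOpen j hx hVW hlt hcl hVo hVb
  set Y : Set ℝ := (fun x : Plane => x 1) '' V with hYdef
  have hYo : IsOpen Y := by
    rw [isOpen_iff_mem_nhds]
    rintro _ ⟨z, hz, rfl⟩
    have ho : IsOpen {t : ℝ | z + (t - z 1) • axis 1 ∈ V} := hVo.preimage (by fun_prop)
    refine Filter.mem_of_superset (ho.mem_nhds (by simpa using hz)) ?_
    intro t ht
    exact ⟨_, ht, (add_smul_axis_self _ _ _).trans (by ring)⟩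
  have hYsub : Y ⊆ Icc (p 1 - Metric.diam V) (p 1 + Metric.diam V) := by
    rintro _ ⟨z, hz, rfl⟩
    have := (abs_coord_sub_le_dist z p 1).trans (Metric.dist_le_diam_of_mem hVb hz hpV)
    rw [abs_le] at this
    exact ⟨by linarith [this.1], by linarith [this.2]⟩
  have hYle : volume Y ≤ ENNReal.ofReal (2 * Metric.diam V) := by
    refine (measure_mono hYsub).trans_eq ?_
    rw [Real.volume_Icc]; ring_nf
  have hYfin : volume Y ≠ ∞ := (hYle.trans_lt ENNReal.ofReal_lt_top).ne
  set b := (volume Y).toReal with hbdef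
  have hYb : volume Y = ENNReal.ofReal b := (ENNReal.ofReal_toReal hYfin).symm
  have hb : 0 < b := ENNReal.toReal_pos (hYo.measure_pos volume ⟨p 1, p, hpV, rfl⟩).ne' hYfin
  have hbM : b ≤ M := by
    have h1 : b ≤ 2 * Metric.diam V := by
      refine ENNReal.toReal_le_of_le_ofReal (by have := Metric.diam_nonneg (s := V); linarith) hYle
    linarith
  have hvert : ∀ {z a c}, (0 : ℝ) ∈ Ioo a c → (∀ t ∈ Ioo a c, z + t • axis 1 ∈ V) → c - a ≤ b := by
    intro z a c h0 hsub
    have h1 : Ioo (z 1 + a) (z 1 + c) ⊆ Y := by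
      intro t ht
      exact ⟨_, hsub (t - z 1) ⟨by linarith [ht.1], by linarith [ht.2]⟩,
        (add_smul_axis_self _ _ _).trans (by ring)⟩
    have h2 := measure_mono (μ := volume) h1
    rw [Real.volume_Ioo, hYb, ENNReal.ofReal_le_ofReal_iff hb.le] at h2
    linarith
  obtain ⟨a₀, b₀, -, w₀, -, -, -⟩ := hwell 0 hpV
  obtain ⟨a₁, b₁, -, w₁, -, -, -⟩ := hwell 1 hpV
  refine le_area_integral hα hβ hαβ hf hVo.measurableSet (hVF.trans h.subset) hYo.measurableSet
    (by norm_num) hb hbM (Y := Y) ?_ w₀.lipConst_ne_zero (w₀.lipConst_partialOn_ne_zero hf.1)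
    (w₁.lipConst_partialOn_ne_zero hf.1) ?_
  · rw [hYb]; exact ENNReal.ofReal_le_ofReal (by linarith)
  rintro _ ⟨z, hz, rfl⟩
  obtain ⟨a, c, hac, hw, h0, hsub, hdiam⟩ := hwell 0 hz
  refine ⟨c - a, Ioo (z 0 + a) (z 0 + c), by linarith, ?_, measurableSet_Ioo, ?_, ?_⟩
  · have := Metric.diam_nonneg (s := V)
    linarith
  · rw [Real.volume_Ioo]; exact ENNReal.ofReal_le_ofReal (by linarith)
  intro y hy0 hy1
  have hyz := exists_eq_add_smul_axis hy1
  have ht : y 0 - z 0 ∈ Ioo a c := ⟨by linarith [hy0.1], by linarith [hy0.2]⟩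
  have hyV : y ∈ V := by rw [hyz]; exact hsub _ ht
  have hyW := h.subset (hVF hyV)
  obtain ⟨a', c', hac', hw', h0', hsub', -⟩ := hwell 1 hyV
  have hd : ∀ s ∈ Icc a c, dist y (z + s • axis 0) ≤ c - a := by
    rw [hyz]; exact IsWell.dist_le _ (Ioo_subset_Icc_self ht)
  have hd' : ∀ s ∈ Icc a' c', dist y (y + s • axis 1) ≤ b := by
    intro s hs
    have := IsWell.dist_le (x := y) (j := 1) 0 (Ioo_subset_Icc_self h0') s hs
    rw [zero_smul, add_zero] at this
    exact this.trans (hvert h0' hsub')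
  exact ⟨hyV, hw.abs_sub_le hf.1 hyW hd, hw'.abs_sub_le hf.1 hyW hd',
    hw.abs_partialOn_le hf.1 hyW hd, hw'.abs_partialOn_le hf.1 hyW hd'⟩

end IsSublevelSet

/-! ### Components meeting the boundary of `W` -/

/-- Away from the corners the frontier is locally a line parallel to the `j`-th axis. -/
lemma exists_axis_of_notMem_corners {W : Set Plane} {q : Plane} (hq : q ∈ frontier W)
    (hqc : q ∉ corners W) : ∃ (j : Fin 2) (r : ℝ), 0 < r ∧
      (∀ t, |t| < r → q + t • axis j ∈ frontier W) ∧
      ∀ k, k ≠ j → ∀ t, t ≠ 0 → |t| < r → q + t • axis k ∉ frontier W := by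
  have h : ∃ r > (0 : ℝ), ∃ i : Fin 2,
      frontier W ∩ Metric.ball q r = {y ∈ Metric.ball q r | y i = q i} := by
    by_contra hcon
    exact hqc ⟨hq, hcon⟩
  obtain ⟨r, hr, i, hi⟩ := h
  have hball : ∀ (t : ℝ) (k : Fin 2), |t| < r → q + t • axis k ∈ Metric.ball q r := by
    intro t k ht
    have h2 := dist_add_smul_axis q t 0 k
    simp only [zero_smul, add_zero, sub_zero] at h2
    rwa [Metric.mem_ball, h2]
  refine ⟨1 - i, r, hr, fun t ht => ?_, fun k hk t ht0 ht hmem => ?_⟩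
  · have : q + t • axis (1 - i) ∈ {y ∈ Metric.ball q r | y i = q i} :=
      ⟨hball t _ ht, add_smul_axis_ne _ _ (by fin_cases i <;> decide)⟩
    rw [← hi] at this
    exact this.1
  · have hki : k = i := by
      fin_cases k <;> fin_cases i <;> simp_all
    subst hki
    have : q + t • axis k ∈ frontier W ∩ Metric.ball q r := ⟨hmem, hball t _ ht⟩
    rw [hi] at this
    have h3 := this.2
    rw [add_smul_axis_self] at h3
    exact ht0 (by linarith)

lemma edge_term_le_boundaryTerm {W : Set Plane} {f : Plane → ℝ} {lam α β : ℝ} (j : Fin 2) :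
    lipConst W f ^ α * (lipConst W (partialOn W f j) ^ β *
        ∫⁻ x in frontier W, (ENNReal.ofReal (|f x - lam| ^ α * |partialOn W f j x| ^ β))⁻¹
          ∂(Measure.hausdorffMeasure 1)) ≤ boundaryTerm W f lam α β := by
  unfold boundaryTerm
  gcongr
  exact Finset.single_le_sum (f := fun i => lipConst W (partialOn W f i) ^ β *
        ∫⁻ x in frontier W, (ENNReal.ofReal (|f x - lam| ^ α * |partialOn W f i x| ^ β))⁻¹
          ∂(Measure.hausdorffMeasure 1)) (fun _ _ => zero_le) (Finset.mem_univ j)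

namespace IsSublevelSet

variable {W F : Set Plane} {f : Plane → ℝ} {lam : ℝ}

/-- The maximal segment of `∂W` around `p` on which `f < lam` stays in the component of `p`, so it
does not reach a corner and `f = lam` at its ends. -/
lemma le_edge_integral_component {α β M : ℝ} (h : IsSublevelSet W f lam F) (hW : IsClosed W)
    (hf : IsC11On f W) (hFb : Bornology.IsBounded F) (hα : 0 < α) (hβ : 0 < β)
    (hαβ : 1 < α + β) (hM : Metric.diam F ≤ M)
    {x : Plane} (hx : x ∈ F) (hK : ∀ p ∈ connectedComponentIn F x, p ∉ corners W)
    {p : Plane} (hp : p ∈ connectedComponentIn F x) (hpW : p ∈ frontier W) (hpl : f p < lam) :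
    ∃ (j : Fin 2) (S : Set Plane), MeasurableSet S ∧ S ⊆ connectedComponentIn F x ∧
      S ⊆ frontier W ∧ ENNReal.ofReal (1 / 4 * M ^ (1 - α - β)) ≤
      lipConst W f ^ α * lipConst W (partialOn W f j) ^ β *
        ∫⁻ x in S, (ENNReal.ofReal (|f x - lam| ^ α * |partialOn W f j x| ^ β))⁻¹
          ∂(Measure.hausdorffMeasure 1) := by
  have hcont := hf.1.continuousOn
  set K := connectedComponentIn F x with hKdef
  have hKF : K ⊆ F := connectedComponentIn_subset F x
  set V := frontier W ∩ K ∩ f ⁻¹' Iio lam with hVdef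
  have hfW : frontier W ⊆ W := hW.frontier_subset
  have hVF : V ⊆ F := fun z hz => hKF hz.1.2
  have hVb : Bornology.IsBounded V := hFb.subset hVF
  have hpV : p ∈ V := ⟨⟨hpW, hp⟩, hpl⟩
  obtain ⟨j, r₀, hr₀, hline, -⟩ := exists_axis_of_notMem_corners hpW (hK p hp)
  have hcl : ∀ y ∈ closure V, y ∉ V → lam ≤ f y := by
    intro y hy hyV
    by_contra! hcon
    have hyW : y ∈ frontier W :=
      closure_minimal (fun z hz => hz.1.1 : V ⊆ frontier W) isClosed_frontier hy
    have hyF := h.mem_of_lt y (hfW hyW) hcon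
    exact hyV ⟨⟨hyW, mem_component_of_mem_closure hx
      (closure_mono (fun z hz => hz.1.2) hy) hyF⟩, hcon⟩
  have hext : ∀ q ∈ V, (∀ r > (0 : ℝ), ∃ s : ℝ, s ≠ 0 ∧ |s| < r ∧ q + s • axis j ∈ frontier W) →
      ∃ d : ℝ, 0 < d ∧ ∀ s ∈ Icc (-d) d, q + s • axis j ∈ V := by
    intro q hq hs
    obtain ⟨k, r, hr, h1, h2⟩ := exists_axis_of_notMem_corners hq.1.1 (hK q hq.1.2)
    have hjk : j = k := by
      by_contra hne
      obtain ⟨s, hs0, hsr, hsW⟩ := hs r hr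
      exact h2 j hne s hs0 hsr hsW
    subst hjk
    have hcq : ContinuousWithinAt (fun t : ℝ => f (q + t • axis j)) (Ioo (-r) r) 0 := by
      exact (hasDerivWithinAt_axis hf.1 (fun t ht => hfW (h1 t (abs_lt.2 ht)))
        ⟨by linarith, hr⟩).continuousWithinAt
    have hev : ∀ᶠ t in nhds (0 : ℝ), f (q + t • axis j) < lam := by
      have := hcq.continuousAt (Ioo_mem_nhds (by linarith) hr)
      exact this.eventually_lt_const (by simpa using hq.2)
    obtain ⟨d, hd, hd'⟩ := Metric.eventually_nhds_iff.1 hev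
    have hm : 0 < min d r := lt_min hd hr
    have hsm : ∀ s ∈ Icc (-(min d r / 2)) (min d r / 2), |s| < min d r := fun s hs => by
      rw [abs_lt]; constructor <;> linarith [hs.1, hs.2]
    have hlt : ∀ s ∈ Icc (-(min d r / 2)) (min d r / 2), q + s • axis j ∈ frontier W ∧
        f (q + s • axis j) < lam := fun s hs =>
      ⟨h1 s ((hsm s hs).trans_le (min_le_right _ _)), hd' (by
        rw [Real.dist_eq, sub_zero]; exact (hsm s hs).trans_le (min_le_left _ _))⟩
    have hmem := add_smul_mem_component (F := F) (x := x) (p := q) (v := axis j)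
      (fun s hs => h.mem_of_lt _ (hfW (hlt s hs).1) (hlt s hs).2) (t₀ := 0)
      ⟨by linarith, by linarith⟩ (by simpa using hq.1.2)
    exact ⟨min d r / 2, by positivity, fun s hs => ⟨⟨(hlt s hs).1, hmem s hs⟩, (hlt s hs).2⟩⟩
  have hnear : ∀ t : ℝ, p + t • axis j ∈ V →
      (∀ r > (0 : ℝ), ∃ s : ℝ, s ≠ 0 ∧ |s| < r ∧ p + (t + s) • axis j ∈ frontier W) →
      ∃ d, 0 < d ∧ ∀ s ∈ Icc (t - d) (t + d), p + s • axis j ∈ V := by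
    intro t ht hs
    obtain ⟨d, hd, hd'⟩ := hext _ ht fun r hr => by
      obtain ⟨s, hs0, hsr, hsW⟩ := hs r hr
      exact ⟨s, hs0, hsr, by rwa [add_assoc, ← add_smul]⟩
    refine ⟨d, hd, fun s hs => ?_⟩
    have := hd' (s - t) ⟨by linarith [hs.1], by linarith [hs.2]⟩
    rwa [add_assoc, ← add_smul, add_sub_cancel] at this
  have hzero : ∀ r > (0 : ℝ), ∃ s : ℝ, s ≠ 0 ∧ |s| < r ∧ p + (0 + s) • axis j ∈ frontier W := by
    intro r hr
    have hm : 0 < min r r₀ / 2 := by have := lt_min hr hr₀; positivity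
    refine ⟨min r r₀ / 2, hm.ne', ?_, ?_⟩
    · rw [abs_of_pos hm]; linarith [min_le_left r r₀]
    · rw [zero_add]
      exact hline _ (by rw [abs_of_pos hm]; linarith [min_le_right r r₀])
  have hVW : closure V ⊆ W := closure_minimal (hVF.trans h.subset) hW
  obtain ⟨a, b, hab, hw, h0, hsub, hclab⟩ := exists_isWell_section (lam := lam) (j := j) hpV hVW
    (fun y hy => hy.2) hcl (fun t ht => abs_le_of_add_smul_axis_mem hVb hpV ht)
    (fun t ht hseg => by
      obtain ⟨d, hd, hd'⟩ := hnear t (hseg t ⟨ht, le_rfl⟩) fun r hr => by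
        rcases eq_or_lt_of_le ht with rfl | ht0
        · exact hzero r hr
        · have hm : 0 < min r t / 2 := by have := lt_min hr ht0; positivity
          refine ⟨-(min r t / 2), by linarith, ?_, ?_⟩
          · rw [abs_neg, abs_of_pos hm]; linarith [min_le_left r t]
          · exact (hseg _ ⟨by linarith [min_le_right r t], by linarith⟩).1.1
      exact ⟨d, hd, fun s hs => hd' s ⟨by linarith [hs.1], hs.2⟩⟩)
    (fun t ht hseg => by
      obtain ⟨d, hd, hd'⟩ := hnear t (hseg t ⟨le_rfl, ht⟩) fun r hr => by
        rcases eq_or_lt_of_le ht with rfl | ht0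
        · exact hzero r hr
        · have hm : 0 < min r (-t) / 2 := by
            have := lt_min hr (neg_pos.2 ht0); positivity
          refine ⟨min r (-t) / 2, by linarith, ?_, ?_⟩
          · rw [abs_of_pos hm]; linarith [min_le_left r (-t)]
          · exact (hseg _ ⟨by linarith, by linarith [min_le_right r (-t)]⟩).1.1
      exact ⟨d, hd, fun s hs => hd' s ⟨hs.1, by linarith [hs.2]⟩⟩)
  have hSV : (fun t : ℝ => p + t • axis j) '' Ioo a b ⊆ V := by
    rintro _ ⟨t, ht, rfl⟩; exact hsub t ht
  refine ⟨j, (fun t : ℝ => p + t • axis j) '' Ioo a b,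
    measurableSet_image_axis p j measurableSet_Ioo, fun z hz => (hSV hz).1.2,
    fun z hz => (hSV hz).1.1, ?_⟩
  have hdiam : b - a ≤ M := by
    have := sub_le_diam hVb hab.le hclab
    linarith [Metric.diam_mono hVF hFb]
  rw [mul_assoc]
  refine le_edge_integral (s := b - a) hα hβ hαβ hf
    (measurableSet_image_axis p j measurableSet_Ioo)
    (hSV.trans (hVF.trans h.subset)) (by norm_num) (by linarith) hdiam ?_ hw.lipConst_ne_zero
    (hw.lipConst_partialOn_ne_zero hf.1) ?_
  · rw [hausdorffMeasure_image_axis, Real.volume_Ioo]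
    exact ENNReal.ofReal_le_ofReal (by linarith)
  · rintro _ ⟨t, ht, rfl⟩
    have hd := IsWell.dist_le (x := p) (j := j) t (Ioo_subset_Icc_self ht)
    have hmem := h.subset (hVF (hsub t ht))
    exact ⟨hw.abs_sub_le hf.1 hmem hd, hw.abs_partialOn_le hf.1 hmem hd⟩

/-- If the component only touches `∂W` at points where `f = lam`, then the derivative along `∂W`
vanishes there, and the singularity of the boundary integral is not integrable since
`α + β > 1`. -/
lemma boundaryTerm_eq_top {α β : ℝ} (h : IsSublevelSet W f lam F) (hW : IsClosed W)
    (hf : IsC11On f W) (hFb : Bornology.IsBounded F) (hα : 0 < α) (hβ : 0 < β)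
    (hαβ : 1 < α + β)
    {x : Plane} (hx : x ∈ F) (hK : ∀ p ∈ connectedComponentIn F x, p ∉ corners W)
    (hne : (connectedComponentIn F x ∩ frontier W).Nonempty)
    (hval : ∀ p ∈ connectedComponentIn F x, p ∈ frontier W → f p = lam) :
    boundaryTerm W f lam α β = ∞ := by
  have hcont := hf.1.continuousOn
  set K := connectedComponentIn F x with hKdef
  have hKF : K ⊆ F := connectedComponentIn_subset F x
  have hfW : frontier W ⊆ W := hW.frontier_subset
  obtain ⟨p₀, hp₀K, hp₀W⟩ := hne
  have hKc : IsCompact (K ∩ frontier W) := by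
    refine Metric.isCompact_of_isClosed_isBounded ?_ (hFb.subset (inter_subset_left.trans hKF))
    refine isClosed_of_closure_subset fun y hy => ?_
    have hyK : y ∈ closure K := closure_mono inter_subset_left hy
    have hyW : y ∈ frontier W := closure_minimal inter_subset_right isClosed_frontier hy
    have hyl := h.le_of_mem_closure hW hcont (closure_mono hKF hyK)
    exact ⟨mem_component_of_mem_closure hx hyK
      (h.mem_of_le (hKF hp₀K) (hval p₀ hp₀K hp₀W) hyl.1 hyl.2), hyW⟩
  -- the lexicographic maximum cannot be continued along either axis
  obtain ⟨p₁, hp₁, hmax₁⟩ := hKc.exists_isMaxOn ⟨p₀, hp₀K, hp₀W⟩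
    (f := fun y : Plane => y 0) (by fun_prop)
  have hKc' : IsCompact (K ∩ frontier W ∩ {y | y 0 = p₁ 0}) :=
    hKc.inter_right (isClosed_eq (by fun_prop) continuous_const)
  obtain ⟨p, ⟨⟨hpK, hpW⟩, hp0⟩, hmax₂⟩ := hKc'.exists_isMaxOn ⟨p₁, hp₁, rfl⟩
    (f := fun y : Plane => y 1) (by fun_prop)
  have hmax : ∀ (j : Fin 2) (t : ℝ), 0 < t → p + t • axis j ∈ frontier W →
      p + t • axis j ∉ K := by
    intro j t ht hW' hK'
    fin_cases j
    · have := hmax₁ ⟨hK', hW'⟩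
      simp only [Fin.zero_eta, mem_ofPred_eq, add_smul_axis_self] at this
      have : p 0 = p₁ 0 := hp0
      linarith
    · have := hmax₂ ⟨⟨hK', hW'⟩, (add_smul_axis_ne p t (by decide)).trans hp0⟩
      simp only [Fin.mk_one, mem_ofPred_eq, add_smul_axis_self] at this
      linarith
  have hpl : f p = lam := hval p hpK hpW
  obtain ⟨j, r, hr, hline, -⟩ := exists_axis_of_notMem_corners hpW (hK p hpK)
  have hlineW : ∀ t : ℝ, |t| < r → p + t • axis j ∈ W := fun t ht => hfW (hline t ht)
  have hder : partialOn W f j p = 0 := by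
    -- otherwise `f < lam` on a segment of the frontier adjacent to `p`
    have key : ∀ s : ℝ, |s| = 1 → ¬ fderivWithin ℝ f W p (s • axis j) < 0 := by
      intro s hs hneg
      have habs : ∀ t ∈ Ico 0 r, |t * s| < r := fun t ht => by
        rw [abs_mul, hs, mul_one, abs_of_nonneg ht.1]; exact ht.2
      obtain ⟨d, hd, hlt⟩ := eventually_lt_of_fderivWithin_neg hf.1 (hfW hpW) hneg hr
        (fun t ht => by rw [smul_smul]; exact hlineW _ (habs t ht))
      have hm : 0 < min d r := lt_min hd hr
      have hmem : ∀ t ∈ Icc 0 (min d r / 2), p + t • s • axis j ∈ F := by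
        intro t ht
        rcases eq_or_lt_of_le ht.1 with rfl | h0
        · simpa using hKF hpK
        · have h1 : t < d := by linarith [ht.2, min_le_left d r]
          have h2 : t < r := by linarith [ht.2, min_le_right d r]
          refine h.mem_of_lt _ ?_ (hpl ▸ hlt t ⟨h0, h1⟩)
          rw [smul_smul]; exact hlineW _ (habs t ⟨h0.le, h2⟩)
      have h2 := add_smul_mem_component hmem (t₀ := 0) ⟨le_rfl, by positivity⟩
        (by simpa using hpK) (min d r / 2) ⟨by positivity, le_rfl⟩
      have h3 := hlt (min d r / 2) ⟨by positivity, by linarith [min_le_left d r]⟩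
      have h4 : p + (min d r / 2) • s • axis j ∈ frontier W := by
        rw [smul_smul]
        exact hline _ (habs _ ⟨by positivity, by linarith [min_le_right d r]⟩)
      exact absurd (hval _ h2 h4) (by rw [← hpl]; exact h3.ne)
    have h1 := key 1 (by simp)
    have h2 := key (-1) (by simp)
    rw [one_smul] at h1
    rw [neg_smul, one_smul, map_neg] at h2
    exact le_antisymm (by simpa [partialOn] using h2) (not_lt.1 h1)
  obtain ⟨b, hb, hbne⟩ : ∃ b ∈ Icc 0 (r / 2), f p ≠ f (p + b • axis j) := by
    by_contra! hcon
    have hmem : ∀ t ∈ Icc 0 (r / 2), p + t • axis j ∈ F := fun t ht =>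
      h.mem_of_le (hKF hpK) hpl (hlineW t (by rw [abs_of_nonneg ht.1]; linarith [ht.2]))
        ((hcon t ht).symm.trans hpl).le
    have h2 := add_smul_mem_component hmem (t₀ := 0) ⟨le_rfl, by positivity⟩
      (by simpa using hpK) (r / 2) ⟨by positivity, le_rfl⟩
    exact hmax j (r / 2) (by positivity)
      (hline _ (by rw [abs_of_pos (by positivity)]; linarith)) h2
  have hbW : ∀ t ∈ Icc 0 b, p + t • axis j ∈ W := fun t ht =>
    hlineW t (by rw [abs_of_nonneg ht.1]; linarith [ht.2, hb.2])
  have hL : lipConst W f ≠ 0 := lipConst_ne_zero (hfW hpW) (hbW b ⟨hb.1, le_rfl⟩) hbne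
  obtain ⟨t₁, ht₁, hne₁⟩ := exists_partialOn_ne_zero hf.1 hb.1 hbW hbne
  have hLj : lipConst W (partialOn W f j) ≠ 0 :=
    lipConst_ne_zero (hbW t₁ ht₁) (hfW hpW) (by rw [hder]; exact hne₁)
  -- the integral over a segment of length `t` at `p` is at least `t ^ (1 - α - β)`
  have hbound : ∀ t ∈ Ioo 0 r, ENNReal.ofReal (t ^ (1 - α - β)) ≤ boundaryTerm W f lam α β := by
    intro t ht
    have hS : (fun t : ℝ => p + t • axis j) '' Ioo 0 t ⊆ frontier W := by
      rintro _ ⟨s, hs, rfl⟩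
      exact hline s (by rw [abs_of_pos hs.1]; exact hs.2.trans ht.2)
    have h1 := le_edge_integral (lam := lam) (κ := 1) (s := t) (M := t) (j := j) hα hβ hαβ hf
      (measurableSet_image_axis p j measurableSet_Ioo) (hS.trans hfW) zero_le_one ht.1 le_rfl
      (by rw [hausdorffMeasure_image_axis, Real.volume_Ioo, one_mul, sub_zero]) hL hLj (by
        rintro _ ⟨s, hs, rfl⟩
        have hd : dist (p + s • axis j) p ≤ t := by
          have h2 := dist_add_smul_axis p s 0 j
          simp only [zero_smul, add_zero, sub_zero] at h2
          rw [h2, abs_of_pos hs.1]; exact hs.2.le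
        have hsW : p + s • axis j ∈ W := hfW (hS ⟨s, hs, rfl⟩)
        have e1 := ofReal_abs_sub_le (g := f) hsW (hfW hpW) hd
        have e2 := ofReal_abs_sub_le (g := partialOn W f j) hsW (hfW hpW) hd
        rw [hpl] at e1
        rw [hder, sub_zero] at e2
        exact ⟨e1, e2⟩)
    rw [one_mul] at h1
    refine h1.trans (le_trans ?_ (edge_term_le_boundaryTerm j))
    gcongr
  by_contra hfin
  have hlim : Filter.Tendsto (fun t : ℝ => t ^ (1 - α - β)) (nhdsWithin 0 (Ioi 0)) Filter.atTop :=
    tendsto_rpow_neg_nhdsGT_zero (by linarith)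
  have hev : ∀ᶠ t in nhdsWithin (0 : ℝ) (Ioi 0), t ^ (1 - α - β) ≤
      (boundaryTerm W f lam α β).toReal := by
    filter_upwards [Ioo_mem_nhdsGT hr] with t ht
    exact (ENNReal.ofReal_le_iff_le_toReal hfin).1 (hbound t ht)
  obtain ⟨t, ht1, ht2⟩ := (hev.and (hlim.eventually_gt_atTop _)).exists
  linarith

end IsSublevelSet

/-! ### Local structure of polyrectangles -/

lemma subset_of_disjoint_frontier {X : Type*} [TopologicalSpace X] {s t : Set X}
    (ht : IsPreconnected t) (hd : ∀ x ∈ t, x ∉ frontier s) {x : X} (hx : x ∈ t) (hxs : x ∈ s) :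
    t ⊆ s := by
  have h1 : t ⊆ interior s ∪ (closure s)ᶜ := fun y hy => by
    by_cases h : y ∈ closure s
    · exact Or.inl (by_contra fun h' => hd y hy ⟨h, h'⟩)
    · exact Or.inr h
  have h2 := ht.subset_left_of_subset_union isOpen_interior isClosed_closure.isOpen_compl
    (disjoint_compl_right.mono_left (interior_subset.trans subset_closure)) h1
    ⟨x, hx, (h1 hx).resolve_right fun h => h (subset_closure hxs)⟩
  exact h2.trans interior_subset

lemma finite_frontier_of_ordConnected {I : Set ℝ} (hcl : IsClosed I) (hI : I.OrdConnected) :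
    (frontier I).Finite := by
  have h1 : {x | IsLeast I x}.Subsingleton := fun x hx y hy => hx.unique hy
  have h2 : {x | IsGreatest I x}.Subsingleton := fun x hx y hy => hx.unique hy
  refine (h1.finite.union h2.finite).subset fun x hx => ?_
  have hxI := hcl.frontier_subset hx
  by_contra hcon
  simp only [mem_union, mem_ofPred_eq, IsLeast, IsGreatest, hxI, true_and, not_or, mem_lowerBounds,
    mem_upperBounds, not_forall, not_le] at hcon
  obtain ⟨⟨u, hu, hux⟩, v, hv, hxv⟩ := hcon
  exact hx.2 (mem_interior_iff_mem_nhds.2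
    (Filter.mem_of_superset (Icc_mem_nhds hux hxv) (hI.out hu hv)))

/-- Near a point that meets no other frontier point, a closed non-degenerate interval is the union
of some of the two half-lines. -/
lemma exists_halfLines {I : Set ℝ} (hI : IsClosedInterval I) {z r a : ℝ} (ha : |a - z| < r)
    (hfr : ∀ t ∈ frontier I, |t - z| < r → t = a) :
    ∃ L R : Prop, ∀ t, |t - z| < r → (t ∈ I ↔ (L ∧ t ≤ a) ∨ (R ∧ a ≤ t)) := by
  obtain ⟨hcl, hord, hint⟩ := hI
  rw [abs_lt] at ha
  have hconst : ∀ u v : ℝ, z - r ≤ u → v ≤ z + r → (a ≤ u ∨ v ≤ a) → ∀ s ∈ Ioo u v, ∀ t ∈ Ioo u v,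
      s ∈ I → t ∈ I := by
    intro u v hu hv hav s hs t ht hsI
    by_contra htI
    refine htI (subset_of_disjoint_frontier isPreconnected_Ioo (fun w hw hwI => ?_) hs hsI ht)
    have := hfr w hwI (abs_lt.2 ⟨by linarith [hw.1], by linarith [hw.2]⟩)
    rcases hav with h | h
    · linarith [hw.1]
    · linarith [hw.2]
  have hl : (a + (z - r)) / 2 ∈ Ioo (z - r) a := ⟨by linarith, by linarith⟩
  have hr : (a + (z + r)) / 2 ∈ Ioo a (z + r) := ⟨by linarith, by linarith⟩
  refine ⟨(a + (z - r)) / 2 ∈ I, (a + (z + r)) / 2 ∈ I, fun t ht => ?_⟩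
  rw [abs_lt] at ht
  have hL : ∀ s ∈ Ioo (z - r) a, ((a + (z - r)) / 2 ∈ I ↔ s ∈ I) := fun s hs =>
    ⟨hconst _ _ le_rfl (by linarith) (Or.inr le_rfl) _ hl _ hs,
      hconst _ _ le_rfl (by linarith) (Or.inr le_rfl) _ hs _ hl⟩
  have hR : ∀ s ∈ Ioo a (z + r), ((a + (z + r)) / 2 ∈ I ↔ s ∈ I) := fun s hs =>
    ⟨hconst _ _ (by linarith) le_rfl (Or.inl le_rfl) _ hr _ hs,
      hconst _ _ (by linarith) le_rfl (Or.inl le_rfl) _ hs _ hr⟩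
  have haL : (a + (z - r)) / 2 ∈ I → a ∈ I := by
    intro h
    have : Ioo (z - r) a ⊆ I := fun s hs => (hL s hs).1 h
    have h2 := closure_mono this
    rw [hcl.closure_eq, closure_Ioo (by linarith)] at h2
    exact h2 ⟨by linarith, le_rfl⟩
  have haR : (a + (z + r)) / 2 ∈ I → a ∈ I := by
    intro h
    have : Ioo a (z + r) ⊆ I := fun s hs => (hR s hs).1 h
    have h2 := closure_mono this
    rw [hcl.closure_eq, closure_Ioo (by linarith)] at h2
    exact h2 ⟨le_rfl, by linarith⟩
  rcases lt_trichotomy t a with h | rfl | h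
  · rw [hL t ⟨by linarith, h⟩]
    exact ⟨fun h' => Or.inl ⟨h', h.le⟩, fun h' => h'.elim (fun h => h.1)
      fun h' => absurd h'.2 (not_le.2 h)⟩
  · refine ⟨fun htI => ?_, fun h => h.elim (fun h => haL h.1) fun h => haR h.1⟩
    -- the interval cannot reduce to the point `a`
    by_contra hcon
    simp only [le_refl, and_true, not_or] at hcon
    obtain ⟨w, hw⟩ := hint
    have hsub : ∀ s ∈ I, s = t := by
      intro s hs
      rcases lt_trichotomy s t with h | h | h
      · exfalso
        have h1 : max s ((t + (z - r)) / 2) ∈ Ioo (z - r) t :=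
          ⟨lt_max_of_lt_right hl.1, max_lt h hl.2⟩
        exact hcon.1 ((hL _ h1).2 (hord.out hs htI ⟨le_max_left _ _, h1.2.le⟩))
      · exact h
      · exfalso
        have h1 : min s ((t + (z + r)) / 2) ∈ Ioo t (z + r) :=
          ⟨lt_min h hr.1, min_lt_of_right_lt hr.2⟩
        exact hcon.2 ((hR _ h1).2 (hord.out htI hs ⟨h1.1.le, min_le_left _ _⟩))
    have h1 : interior I ⊆ interior {t} := interior_mono fun s hs => hsub s hs
    simpa using h1 hw
  · rw [hR t ⟨h, by linarith⟩]
    exact ⟨fun h' => Or.inr ⟨h', h.le⟩, fun h' => h'.elim (fun h' => absurd h'.2 (not_le.2 h))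
      fun h => h.1⟩

/-- At a scale smaller than half the gaps of a finite set, an interval sees at most one of its
points, even when it is slightly enlarged. -/
lemma exists_isolated {X : Set ℝ} (hX : X.Finite) : ∃ δ > 0, ∀ z r : ℝ, 0 < r → r < δ →
    ∃ a, |a - z| ≤ r ∧ ∀ᶠ r' in nhdsWithin r (Ioi r), ∀ t ∈ X, |t - z| < r' → t = a := by
  obtain ⟨g, hg, hgap⟩ : ∃ g > 0, ∀ s ∈ X, ∀ t ∈ X, s ≠ t → g ≤ |s - t| := by
    have hY := (hX.prod hX).image fun p : ℝ × ℝ => |p.1 - p.2|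
    have h1 : ∀ᶠ g in nhdsWithin (0 : ℝ) (Ioi 0),
        ∀ y ∈ (fun p : ℝ × ℝ => |p.1 - p.2|) '' X ×ˢ X, 0 < y → g ≤ y := by
      rw [Filter.eventually_all_finite hY]
      intro y hy
      by_cases h : 0 < y
      · filter_upwards [Ioo_mem_nhdsGT h] with g hg _ using hg.2.le
      · exact Filter.Eventually.of_forall fun g h' => absurd h' h
    obtain ⟨g, hg1, hg2⟩ := (h1.and self_mem_nhdsWithin).exists
    exact ⟨g, hg2, fun s hs t ht hst => hg1 _ ⟨(s, t), ⟨hs, ht⟩, rfl⟩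
      (abs_pos.2 (sub_ne_zero.2 hst))⟩
  refine ⟨g / 2, by positivity, fun z r hr hrg => ?_⟩
  have hfar : ∀ᶠ r' in nhdsWithin r (Ioi r), ∀ t ∈ X, r < |t - z| → r' ≤ |t - z| := by
    rw [Filter.eventually_all_finite hX]
    intro t _
    by_cases h : r < |t - z|
    · filter_upwards [Ioo_mem_nhdsGT h] with r' hr' _ using hr'.2.le
    · exact Filter.Eventually.of_forall fun r' h' => absurd h' h
  by_cases hex : ∃ a ∈ X, |a - z| ≤ r
  · obtain ⟨a, haX, ha⟩ := hex
    refine ⟨a, ha, hfar.mono fun r' h t ht htr => ?_⟩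
    have htr' : |t - z| ≤ r := by
      by_contra! hcon
      exact absurd htr (not_lt.2 (h t ht hcon))
    by_contra hne
    have h1 := hgap t ht a haX hne
    have h2 : |t - a| ≤ |t - z| + |a - z| := by
      have := abs_sub_le t z a
      rwa [abs_sub_comm z a] at this
    linarith
  · push Not at hex
    refine ⟨z, by simpa using hr.le, hfar.mono fun r' h t ht htr => ?_⟩
    exact absurd htr (not_lt.2 (h t ht (hex t ht)))

lemma IsPolyrectangle.isClosed {W : Set Plane} (hW : IsPolyrectangle W) : IsClosed W := by
  obtain ⟨n, I, J, hIJ, -, rfl⟩ := hW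
  refine isClosed_iUnion_of_finite fun k => ?_
  exact ((hIJ k).1.1.preimage (f := fun x : Plane => x 0) (by fun_prop)).inter
    ((hIJ k).2.1.preimage (f := fun x : Plane => x 1) (by fun_prop))

/-- At small scales a square contains an apparent corner of the polyrectangle `W`, or misses `W`,
or lies in `W`, or intersects `W` in a half-plane bounded by a line parallel to an axis. -/
lemma IsPolyrectangle.exists_local_structure {W : Set Plane} (hW : IsPolyrectangle W) :
    ∃ δ > 0, ∀ (z : Plane) (r : ℝ), 0 < r → r < δ →
      (∃ p ∈ corners W, ∀ i, |p i - z i| ≤ r) ∨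
      (∀ x : Plane, (∀ i, |x i - z i| ≤ r) → x ∉ W) ∨
      (∀ x : Plane, (∀ i, |x i - z i| ≤ r) → x ∈ W) ∨
      ∃ (i : Fin 2) (s a : ℝ), (s = 1 ∨ s = -1) ∧ |a - z i| ≤ r ∧
        ∀ x : Plane, (∀ i, |x i - z i| ≤ r) → (x ∈ W ↔ s * x i ≤ s * a) := by
  obtain ⟨n, I, J, hIJ, -, hWeq⟩ := hW
  obtain ⟨δ₀, hδ₀, h₀⟩ := exists_isolated (X := ⋃ k, frontier (I k))
    (finite_iUnion fun k => finite_frontier_of_ordConnected (hIJ k).1.1 (hIJ k).1.2.1)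
  obtain ⟨δ₁, hδ₁, h₁⟩ := exists_isolated (X := ⋃ k, frontier (J k))
    (finite_iUnion fun k => finite_frontier_of_ordConnected (hIJ k).2.1 (hIJ k).2.2.1)
  refine ⟨min δ₀ δ₁, lt_min hδ₀ hδ₁, fun z r hr hrδ => ?_⟩
  obtain ⟨a, ha, hea⟩ := h₀ (z 0) r hr (hrδ.trans_le (min_le_left _ _))
  obtain ⟨b, hb, heb⟩ := h₁ (z 1) r hr (hrδ.trans_le (min_le_right _ _))
  obtain ⟨r', ⟨hra, hrb⟩, hrr'⟩ := ((hea.and heb).and self_mem_nhdsWithin).exists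
  choose L₀ R₀ hLR₀ using fun k => exists_halfLines (hIJ k).1 (ha.trans_lt hrr')
    fun t ht htr => hra t (mem_iUnion.2 ⟨k, ht⟩) htr
  choose L₁ R₁ hLR₁ using fun k => exists_halfLines (hIJ k).2 (hb.trans_lt hrr')
    fun t ht htr => hrb t (mem_iUnion.2 ⟨k, ht⟩) htr
  obtain ⟨LL, LR, RL, RR, hmem⟩ : ∃ LL LR RL RR : Prop, ∀ x : Plane, |x 0 - z 0| < r' →
      |x 1 - z 1| < r' → (x ∈ W ↔ (LL ∧ x 0 ≤ a ∧ x 1 ≤ b) ∨ (LR ∧ x 0 ≤ a ∧ b ≤ x 1) ∨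
        (RL ∧ a ≤ x 0 ∧ x 1 ≤ b) ∨ (RR ∧ a ≤ x 0 ∧ b ≤ x 1)) := by
    refine ⟨∃ k, L₀ k ∧ L₁ k, ∃ k, L₀ k ∧ R₁ k, ∃ k, R₀ k ∧ L₁ k, ∃ k, R₀ k ∧ R₁ k,
      fun x hx0 hx1 => ?_⟩
    rw [hWeq, mem_iUnion]
    have : ∀ k, x ∈ rect (I k) (J k) ↔ ((L₀ k ∧ x 0 ≤ a) ∨ (R₀ k ∧ a ≤ x 0)) ∧
        ((L₁ k ∧ x 1 ≤ b) ∨ (R₁ k ∧ b ≤ x 1)) := fun k => by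
      rw [← hLR₀ k _ hx0, ← hLR₁ k _ hx1]; rfl
    simp only [this]
    constructor
    · rintro ⟨k, h1 | h1, h2 | h2⟩
      · exact Or.inl ⟨⟨k, h1.1, h2.1⟩, h1.2, h2.2⟩
      · exact Or.inr (Or.inl ⟨⟨k, h1.1, h2.1⟩, h1.2, h2.2⟩)
      · exact Or.inr (Or.inr (Or.inl ⟨⟨k, h1.1, h2.1⟩, h1.2, h2.2⟩))
      · exact Or.inr (Or.inr (Or.inr ⟨⟨k, h1.1, h2.1⟩, h1.2, h2.2⟩))
    · rintro (⟨⟨k, h1, h2⟩, h3, h4⟩ | ⟨⟨k, h1, h2⟩, h3, h4⟩ | ⟨⟨k, h1, h2⟩, h3, h4⟩ |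
        ⟨⟨k, h1, h2⟩, h3, h4⟩)
      exacts [⟨k, Or.inl ⟨h1, h3⟩, Or.inl ⟨h2, h4⟩⟩, ⟨k, Or.inl ⟨h1, h3⟩, Or.inr ⟨h2, h4⟩⟩,
        ⟨k, Or.inr ⟨h1, h3⟩, Or.inl ⟨h2, h4⟩⟩, ⟨k, Or.inr ⟨h1, h3⟩, Or.inr ⟨h2, h4⟩⟩]
  have hbox : ∀ x : Plane, (∀ i, |x i - z i| ≤ r) → (x ∈ W ↔ (LL ∧ x 0 ≤ a ∧ x 1 ≤ b) ∨
      (LR ∧ x 0 ≤ a ∧ b ≤ x 1) ∨ (RL ∧ a ≤ x 0 ∧ x 1 ≤ b) ∨ (RR ∧ a ≤ x 0 ∧ b ≤ x 1)) :=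
    fun x hx => hmem x ((hx 0).trans_lt hrr') ((hx 1).trans_lt hrr')
  by_cases hA : (LL ↔ LR) ∧ (RL ↔ RR)
  · have hA' : ∀ x : Plane, (∀ i, |x i - z i| ≤ r) →
        (x ∈ W ↔ (LL ∧ x 0 ≤ a) ∨ (RR ∧ a ≤ x 0)) := by
      intro x hx
      rw [hbox x hx, ← hA.1, hA.2]
      have := le_total (x 1) b
      tauto
    refine Or.inr ?_
    by_cases h1 : LL <;> by_cases h2 : RR
    · refine Or.inr (Or.inl fun x hx => (hA' x hx).2 ?_)
      simpa [h1, h2] using le_total (x 0) a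
    · exact Or.inr (Or.inr ⟨0, 1, a, Or.inl rfl, ha, fun x hx => by
        rw [hA' x hx]; simp [h1, h2]⟩)
    · exact Or.inr (Or.inr ⟨0, -1, a, Or.inr rfl, ha, fun x hx => by
        rw [hA' x hx]; simp [h1, h2]⟩)
    · exact Or.inl fun x hx => by rw [hA' x hx]; simp [h1, h2]
  by_cases hB : (LL ↔ RL) ∧ (LR ↔ RR)
  · have hB' : ∀ x : Plane, (∀ i, |x i - z i| ≤ r) →
        (x ∈ W ↔ (LL ∧ x 1 ≤ b) ∨ (RR ∧ b ≤ x 1)) := by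
      intro x hx
      rw [hbox x hx, ← hB.1, hB.2]
      have := le_total (x 0) a
      tauto
    refine Or.inr ?_
    by_cases h1 : LL <;> by_cases h2 : RR
    · refine Or.inr (Or.inl fun x hx => (hB' x hx).2 ?_)
      simpa [h1, h2] using le_total (x 1) b
    · exact Or.inr (Or.inr ⟨1, 1, b, Or.inl rfl, hb, fun x hx => by
        rw [hB' x hx]; simp [h1, h2]⟩)
    · exact Or.inr (Or.inr ⟨1, -1, b, Or.inr rfl, hb, fun x hx => by
        rw [hB' x hx]; simp [h1, h2]⟩)
    · exact Or.inl fun x hx => by rw [hB' x hx]; simp [h1, h2]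
  -- in the remaining cases the point `(a, b)` is a corner
  refine Or.inl ⟨!₂[a, b], ?_, fun i => by fin_cases i <;> assumption⟩
  have hρ : 0 < min (r' - |a - z 0|) (r' - |b - z 1|) :=
    lt_min (by linarith) (by linarith)
  set ρ := min (r' - |a - z 0|) (r' - |b - z 1|) with hρdef
  have hq : ∀ u v : ℝ, |u| < ρ → |v| < ρ → (!₂[a + u, b + v] ∈ W ↔
      (LL ∧ u ≤ 0 ∧ v ≤ 0) ∨ (LR ∧ u ≤ 0 ∧ 0 ≤ v) ∨ (RL ∧ 0 ≤ u ∧ v ≤ 0) ∨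
        (RR ∧ 0 ≤ u ∧ 0 ≤ v)) := by
    intro u v hu hv
    rw [hmem]
    · simp
    · have h1 := abs_add_le (a - z 0) u
      have h2 := min_le_left (r' - |a - z 0|) (r' - |b - z 1|)
      change |a + u - z 0| < r'
      rw [show a + u - z 0 = a - z 0 + u by ring]; linarith
    · have h1 := abs_add_le (b - z 1) v
      have h2 := min_le_right (r' - |a - z 0|) (r' - |b - z 1|)
      change |b + v - z 1| < r'
      rw [show b + v - z 1 = b - z 1 + v by ring]; linarith
  have hdist : ∀ u v R : ℝ, |u| + |v| < R → !₂[a + u, b + v] ∈ Metric.ball !₂[a, b] R := by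
    intro u v R h
    rw [Metric.mem_ball]
    refine (dist_le_abs_add_abs _ _).trans_lt ?_
    simpa using h
  have hsame : ∀ (H : Set Plane), IsPreconnected H → (∀ x ∈ H, x ∉ frontier W) → ∀ x ∈ H, ∀ y ∈ H,
      (x ∈ W ↔ y ∈ W) := fun H h1 h2 x hx y hy =>
    ⟨fun h => subset_of_disjoint_frontier h1 h2 hx h hy,
      fun h => subset_of_disjoint_frontier h1 h2 hy h hx⟩
  have hquad : ∀ e : ℝ, 0 < e → e < ρ → (!₂[a + -e, b + -e] ∈ W ↔ LL) ∧
      (!₂[a + -e, b + e] ∈ W ↔ LR) ∧ (!₂[a + e, b + -e] ∈ W ↔ RL) ∧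
      (!₂[a + e, b + e] ∈ W ↔ RR) := by
    intro e he heρ
    have e1 : |e| < ρ := by rwa [abs_of_pos he]
    have e2 : |-e| < ρ := by rwa [abs_neg]
    refine ⟨?_, ?_, ?_, ?_⟩
    · rw [hq _ _ e2 e2]; simp [he.le, he.not_ge]
    · rw [hq _ _ e2 e1]; simp [he.le, he.not_ge]
    · rw [hq _ _ e1 e2]; simp [he.le, he.not_ge]
    · rw [hq _ _ e1 e1]; simp [he.le, he.not_ge]
  have hsmall : ∀ R > 0, ∃ e, 0 < e ∧ e < ρ ∧ e + e < R := fun R hR =>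
    ⟨min ρ R / 4, by have := lt_min hρ hR; positivity, by
      linarith [min_le_left ρ R, lt_min hρ hR], by linarith [min_le_right ρ R, lt_min hρ hR]⟩
  refine ⟨?_, ?_⟩
  · by_contra hfr
    obtain ⟨R, hR, hball⟩ := Metric.isOpen_iff.1 isClosed_frontier.isOpen_compl _ hfr
    obtain ⟨e, he, heρ, heR⟩ := hsmall R hR
    have hs := hsame _ (convex_ball _ R).isPreconnected hball
    obtain ⟨h1, h2, h3, h4⟩ := hquad e he heρ
    have k1 := hdist (-e) (-e) R (by simpa [abs_of_pos he] using heR)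
    have k2 := hdist (-e) e R (by simpa [abs_of_pos he] using heR)
    have k3 := hdist e (-e) R (by simpa [abs_of_pos he] using heR)
    have k4 := hdist e e R (by simpa [abs_of_pos he] using heR)
    exact hA ⟨by rw [← h1, ← h2]; exact hs _ k1 _ k2, by rw [← h3, ← h4]; exact hs _ k3 _ k4⟩
  · rintro ⟨R, hR, i, hi⟩
    obtain ⟨e, he, heρ, heR⟩ := hsmall R hR
    obtain ⟨h1, h2, h3, h4⟩ := hquad e he heρ
    have k1 := hdist (-e) (-e) R (by simpa [abs_of_pos he] using heR)
    have k2 := hdist (-e) e R (by simpa [abs_of_pos he] using heR)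
    have k3 := hdist e (-e) R (by simpa [abs_of_pos he] using heR)
    have k4 := hdist e e R (by simpa [abs_of_pos he] using heR)
    have hdisj : ∀ x ∈ Metric.ball (!₂[a, b] : Plane) R, x i ≠ (!₂[a, b] : Plane) i →
        x ∉ frontier W := by
      intro x hx hxi hxW
      have : x ∈ frontier W ∩ Metric.ball !₂[a, b] R := ⟨hxW, hx⟩
      rw [hi] at this
      exact hxi this.2
    have hlow := hsame (Metric.ball (!₂[a, b] : Plane) R ∩ {x | x i < (!₂[a, b] : Plane) i})
      ((convex_ball _ R).inter (convex_halfSpace_lt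
        (EuclideanSpace.proj (𝕜 := ℝ) i).isLinear _)).isPreconnected
      fun x hx => hdisj x hx.1 (ne_of_lt hx.2)
    have hupp := hsame (Metric.ball (!₂[a, b] : Plane) R ∩ {x | (!₂[a, b] : Plane) i < x i})
      ((convex_ball _ R).inter (convex_halfSpace_gt
        (EuclideanSpace.proj (𝕜 := ℝ) i).isLinear _)).isPreconnected
      fun x hx => hdisj x hx.1 (ne_of_gt hx.2)
    fin_cases i
    · refine hA ⟨?_, ?_⟩
      · rw [← h1, ← h2]; exact hlow _ ⟨k1, by simpa using he⟩ _ ⟨k2, by simpa using he⟩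
      · rw [← h3, ← h4]; exact hupp _ ⟨k3, by simpa using he⟩ _ ⟨k4, by simpa using he⟩
    · refine hB ⟨?_, ?_⟩
      · rw [← h1, ← h3]; exact hlow _ ⟨k1, by simpa using he⟩ _ ⟨k3, by simpa using he⟩
      · rw [← h2, ← h4]; exact hupp _ ⟨k2, by simpa using he⟩ _ ⟨k4, by simpa using he⟩

/-! ### Pixels -/

/-- The point of the lattice `ε ℤ²` with index `z`. -/
noncomputable def latticePoint (ε : ℝ) (z : Fin 2 → ℤ) : Plane := WithLp.toLp 2 fun i => ε * z i

/-- The index of the half-open pixel that contains `x`. -/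
noncomputable def pixelIndex (ε : ℝ) (x : Plane) : Fin 2 → ℤ := fun i => ⌊x i / ε + 1 / 2⌋

@[simp] lemma latticePoint_apply (ε : ℝ) (z : Fin 2 → ℤ) (i : Fin 2) :
    latticePoint ε z i = ε * z i := rfl

lemma latticePoint_add_single (ε : ℝ) (z : Fin 2 → ℤ) (j : Fin 2) (m : ℤ) :
    latticePoint ε (z + Pi.single j m) = latticePoint ε z + (ε * m) • axis j := by
  ext i
  rcases eq_or_ne i j with rfl | h
  · rw [add_smul_axis_self]; simp; ring
  · rw [add_smul_axis_ne _ _ h]; simp [h]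

lemma floor_eq_iff_pixel {ε : ℝ} (hε : 0 < ε) {t : ℝ} {n : ℤ} :
    ⌊t / ε + 1 / 2⌋ = n ↔ ε * n - ε / 2 ≤ t ∧ t < ε * n + ε / 2 := by
  rw [Int.floor_eq_iff]
  have h1 : ε * (t / ε) = t := mul_div_cancel₀ t hε.ne'
  constructor
  · rintro ⟨h2, h3⟩
    have h4 := mul_le_mul_of_nonneg_left h2 hε.le
    have h5 := mul_lt_mul_of_pos_left h3 hε
    constructor <;> nlinarith
  · rintro ⟨h2, h3⟩
    constructor
    · rw [← sub_le_iff_le_add, le_div_iff₀ hε]; nlinarith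
    · rw [← lt_sub_iff_add_lt, div_lt_iff₀ hε]; nlinarith

lemma abs_sub_latticePoint_le {ε : ℝ} (hε : 0 < ε) {x : Plane} {z : Fin 2 → ℤ}
    (h : pixelIndex ε x = z) (i : Fin 2) : |x i - latticePoint ε z i| ≤ ε / 2 := by
  obtain ⟨h1, h2⟩ := (floor_eq_iff_pixel hε).1 (congrFun h i)
  rw [latticePoint_apply, abs_le]
  constructor <;> linarith

lemma pixelIndex_latticePoint {ε : ℝ} (hε : 0 < ε) (z : Fin 2 → ℤ) :
    pixelIndex ε (latticePoint ε z) = z := by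
  ext i
  refine (floor_eq_iff_pixel hε).2 ⟨?_, ?_⟩ <;> rw [latticePoint_apply] <;> linarith

lemma mem_gaussApprox_iff {ε : ℝ} (hε : 0 < ε) {A : Set Plane} {x : Plane} :
    x ∈ gaussApprox ε A ↔ latticePoint ε (pixelIndex ε x) ∈ A := by
  simp only [gaussApprox, mem_iUnion, exists_prop]
  constructor
  · rintro ⟨y, ⟨⟨z, hz⟩, hyA⟩, hxy⟩
    have hy : y = latticePoint ε z := by ext i; exact hz i
    have : pixelIndex ε x = z := by
      ext i
      have h1 := (hxy i).1
      have h2 := (hxy i).2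
      rw [hz i] at h1 h2
      exact (floor_eq_iff_pixel hε).2 ⟨by linarith, by linarith⟩
    rwa [this, ← hy]
  · intro h
    refine ⟨_, ⟨⟨pixelIndex ε x, fun i => rfl⟩, h⟩, fun i => ?_⟩
    obtain ⟨h1, h2⟩ := (floor_eq_iff_pixel hε).1 (rfl : ⌊x i / ε + 1 / 2⌋ = pixelIndex ε x i)
    change x i - ε * ⌊x i / ε + 1 / 2⌋ ∈ _
    exact ⟨by linarith, by linarith⟩

lemma isPreconnected_pixel {ε : ℝ} (hε : 0 < ε) (z : Fin 2 → ℤ) :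
    IsPreconnected {x | pixelIndex ε x = z} := by
  have h : {x | pixelIndex ε x = z} =
      ⋂ i, (fun x : Plane => x i) ⁻¹' Ico (ε * z i - ε / 2) (ε * z i + ε / 2) := by
    ext x
    simp only [mem_ofPred_eq, mem_iInter, mem_preimage, mem_Ico, ← floor_eq_iff_pixel hε]
    exact funext_iff
  rw [h]
  exact (convex_iInter fun i => (convex_Ico _ _).is_linear_preimage
    (EuclideanSpace.proj (𝕜 := ℝ) i).isLinear).isPreconnected

lemma measurable_pixelIndex (ε : ℝ) : Measurable (pixelIndex ε) :=
  measurable_pi_iff.2 fun i => Int.measurable_floor.comp (by fun_prop)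

/-- The indices of the pixels that make up a component `Q` of the Gauss approximation of `A`. -/
def cells (ε : ℝ) (A Q : Set Plane) : Set (Fin 2 → ℤ) :=
  {z | latticePoint ε z ∈ A ∧ latticePoint ε z ∈ Q}

section Cells

variable {ε : ℝ} {A Q : Set Plane}

lemma eq_component_of_mem (hQ : Q ∈ boundedComponents A) {x : Plane} (hx : x ∈ Q) :
    x ∈ A ∧ Q = connectedComponentIn A x := by
  obtain ⟨⟨y, hy, rfl⟩, -⟩ := hQ
  exact ⟨connectedComponentIn_subset _ _ hx, connectedComponentIn_eq hx⟩

lemma boundedComponents_eq_of_mem {Q' : Set Plane} (hQ : Q ∈ boundedComponents A)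
    (hQ' : Q' ∈ boundedComponents A) {x : Plane} (hx : x ∈ Q) (hx' : x ∈ Q') : Q = Q' :=
  (eq_component_of_mem hQ hx).2.trans (eq_component_of_mem hQ' hx').2.symm

lemma cells_nonempty (hε : 0 < ε) (hQ : Q ∈ boundedComponents (gaussApprox ε A)) :
    (cells ε A Q).Nonempty := by
  obtain ⟨⟨x, hx, rfl⟩, -⟩ := hQ
  have h := (mem_gaussApprox_iff hε).1 hx
  refine ⟨pixelIndex ε x, h, ?_⟩
  exact (isPreconnected_pixel hε (pixelIndex ε x)).subset_connectedComponentIn rfl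
    (fun y hy => (mem_gaussApprox_iff hε).2 (by rwa [show pixelIndex ε y = _ from hy]))
    (pixelIndex_latticePoint hε _)

lemma cells_unique {Q' : Set Plane} (hQ : Q ∈ boundedComponents (gaussApprox ε A))
    (hQ' : Q' ∈ boundedComponents (gaussApprox ε A)) {z : Fin 2 → ℤ} (hz : z ∈ cells ε A Q)
    (hz' : z ∈ cells ε A Q') : Q = Q' :=
  boundedComponents_eq_of_mem hQ hQ' hz.2 hz'.2

/-- Pixels that share a side are in the same component. -/
lemma cells_step (hε : 0 < ε) (hQ : Q ∈ boundedComponents (gaussApprox ε A)) {z : Fin 2 → ℤ}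
    (hz : z ∈ cells ε A Q) {j : Fin 2} {σ : ℤ} (hσ : |σ| = 1)
    (h : latticePoint ε (z + Pi.single j σ) ∈ A) : z + Pi.single j σ ∈ cells ε A Q := by
  obtain ⟨-, hQeq⟩ := eq_component_of_mem hQ hz.2
  refine ⟨h, ?_⟩
  rw [hQeq]
  have hσ' : σ = 1 ∨ σ = -1 := by
    rcases abs_choice σ with h | h <;> omega
  have hmem : ∀ t ∈ Icc 0 ε, latticePoint ε z + t • ((σ : ℝ) • axis j) ∈ gaussApprox ε A := by
    intro t ht
    rw [mem_gaussApprox_iff hε, smul_smul]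
    have hi : ∀ i ≠ j, pixelIndex ε (latticePoint ε z + (t * σ) • axis j) i = z i := by
      intro i hij
      have h1 := congrFun (pixelIndex_latticePoint hε z) i
      rw [← h1]
      simp only [pixelIndex, add_smul_axis_ne _ _ hij]
    have hj : pixelIndex ε (latticePoint ε z + (t * σ) • axis j) j = z j ∨
        pixelIndex ε (latticePoint ε z + (t * σ) • axis j) j = z j + σ := by
      simp only [pixelIndex, add_smul_axis_self, floor_eq_iff_pixel hε, latticePoint_apply]
      obtain ⟨h0, h1⟩ := ht
      rcases hσ' with rfl | rfl
      · rcases lt_or_ge t (ε / 2) with h | h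
        · left; push_cast; constructor <;> linarith
        · right; push_cast; constructor <;> linarith
      · rcases le_or_gt t (ε / 2) with h | h
        · left; push_cast; constructor <;> linarith
        · right; push_cast; constructor <;> linarith
    rcases hj with hj | hj
    · have : pixelIndex ε (latticePoint ε z + (t * σ) • axis j) = z := by
        ext i
        rcases eq_or_ne i j with rfl | hij
        · exact hj
        · exact hi i hij
      rw [this]; exact hz.1
    · have : pixelIndex ε (latticePoint ε z + (t * σ) • axis j) = z + Pi.single j σ := by
        ext i
        rcases eq_or_ne i j with rfl | hij
        · simpa using hj
        · simpa [hij] using hi i hij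
      rw [this]; exact h
  have h2 := add_smul_mem_component hmem (x := latticePoint ε z) (t₀ := 0) ⟨le_rfl, hε.le⟩
    (by
      rw [zero_smul, add_zero]
      refine mem_connectedComponentIn ?_
      rw [mem_gaussApprox_iff hε, pixelIndex_latticePoint hε]; exact hz.1) ε ⟨hε.le, le_rfl⟩
  rwa [latticePoint_add_single, mul_smul]

end Cells

lemma exists_maximal_int_Icc {P : ℤ → Prop} (h0 : P 0) {B : ℝ} (hB : ∀ m : ℤ, P m → |(m : ℝ)| ≤ B) :
    ∃ k l : ℤ, k ≤ 0 ∧ 0 ≤ l ∧ (∀ m, k ≤ m → m ≤ l → P m) ∧ ¬ P (k - 1) ∧ ¬ P (l + 1) := by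
  have key : ∀ P : ℤ → Prop, P 0 → (∀ m : ℤ, P m → |(m : ℝ)| ≤ B) →
      ∃ l : ℤ, 0 ≤ l ∧ (∀ m, 0 ≤ m → m ≤ l → P m) ∧ ¬ P (l + 1) := by
    intro P h0 hB
    classical
    have hex : ∃ n : ℕ, ¬ P n := by
      obtain ⟨n, hn⟩ := exists_nat_gt B
      refine ⟨n, fun h => ?_⟩
      have := (le_abs_self _).trans (hB _ h)
      push_cast at this
      linarith
    have hpos : Nat.find hex ≠ 0 := fun h => by
      have := Nat.find_spec hex
      rw [h] at this
      exact this h0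
    refine ⟨(Nat.find hex : ℤ) - 1, by omega, fun m hm1 hm2 => ?_, by
      rw [sub_add_cancel]; exact Nat.find_spec hex⟩
    obtain ⟨n, rfl⟩ := Int.eq_ofNat_of_zero_le hm1
    exact not_not.1 (Nat.find_min hex (by omega))
  obtain ⟨l, hl, hl1, hl2⟩ := key P h0 hB
  obtain ⟨k, hk, hk1, hk2⟩ := key (fun m => P (-m)) (by simpa using h0) fun m hm => by
    simpa using hB _ hm
  refine ⟨-k, l, by omega, hl, fun m hm1 hm2 => ?_, by
    rwa [show -k - 1 = -(k + 1) by ring], hl2⟩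
  rcases le_total 0 m with h | h
  · exact hl1 m h hm2
  · have := hk1 (-m) (by omega) (by omega)
    rwa [neg_neg] at this

/-! ### Runs of pixels -/

section Runs

variable {W F Q : Set Plane} {f : Plane → ℝ} {lam ε : ℝ}

lemma mul_sub_le_diam (hε : 0 < ε) (hFb : Bornology.IsBounded F) {z : Fin 2 → ℤ} {j : Fin 2}
    {k l : ℤ} (hk : latticePoint ε (z + Pi.single j k) ∈ F)
    (hl : latticePoint ε (z + Pi.single j l) ∈ F) : ε * |((l - k : ℤ) : ℝ)| ≤ Metric.diam F := by
  have h := Metric.dist_le_diam_of_mem hFb hl hk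
  rw [latticePoint_add_single, latticePoint_add_single, dist_add_smul_axis, ← mul_sub, abs_mul,
    abs_of_pos hε] at h
  exact_mod_cast h

/-- A maximal run of cells of a component through a given cell, parallel to an axis; the lattice
points that follow its ends are not in `F`. -/
lemma exists_run (hε : 0 < ε) (hFb : Bornology.IsBounded F)
    (hQ : Q ∈ boundedComponents (gaussApprox ε F)) {z : Fin 2 → ℤ} (hz : z ∈ cells ε F Q)
    (j : Fin 2) : ∃ k l : ℤ, k ≤ 0 ∧ 0 ≤ l ∧
      (∀ m, k ≤ m → m ≤ l → z + Pi.single j m ∈ cells ε F Q) ∧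
      latticePoint ε (z + Pi.single j (k - 1)) ∉ F ∧
      latticePoint ε (z + Pi.single j (l + 1)) ∉ F ∧
      ε * ((l : ℝ) - k) ≤ Metric.diam F := by
  obtain ⟨k, l, hk, hl, h1, h2, h3⟩ := exists_maximal_int_Icc
    (P := fun m => z + Pi.single j m ∈ cells ε F Q) (B := Metric.diam F / ε) (by simpa using hz)
    fun m hm => by
      rw [le_div_iff₀ hε, mul_comm]
      have := mul_sub_le_diam hε hFb (z := z) (j := j) (k := 0) (l := m) (by simpa using hz.1) hm.1
      simpa using this
  have hstep : ∀ m n : ℤ, |n| = 1 → z + Pi.single j m ∈ cells ε F Q →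
      z + Pi.single j (m + n) ∉ cells ε F Q →
      latticePoint ε (z + Pi.single j (m + n)) ∉ F := by
    intro m n hn hm hmn hF
    rw [Pi.single_add, ← add_assoc] at hmn hF
    exact hmn (cells_step hε hQ hm hn hF)
  refine ⟨k, l, hk, hl, h1, ?_, ?_, ?_⟩
  · exact hstep k (-1) (by simp) (h1 k le_rfl (by omega)) h2
  · exact hstep l 1 (by simp) (h1 l (by omega) le_rfl) h3
  · have := mul_sub_le_diam hε hFb (h1 k le_rfl (by omega)).1 (h1 l (by omega) le_rfl).1
    refine le_trans (mul_le_mul_of_nonneg_left ?_ hε.le) this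
    push_cast
    exact le_abs_self _

lemma exists_int_near {k l : ℤ} (hε : 0 < ε) (hkl : k ≤ l) {t : ℝ}
    (ht : t ∈ Icc (ε * (k - 1)) (ε * (l + 1))) :
    ∃ m, k ≤ m ∧ m ≤ l ∧ |t - ε * m| ≤ ε := by
  obtain ⟨h1, h2⟩ := ht
  have hf1 := Int.floor_le (t / ε)
  have hf2 := Int.lt_floor_add_one (t / ε)
  rw [le_div_iff₀ hε] at hf1
  rw [div_lt_iff₀ hε] at hf2
  rcases lt_or_ge ⌊t / ε⌋ k with hk | hk
  · refine ⟨k, le_rfl, hkl, ?_⟩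
    have : ((⌊t / ε⌋ : ℝ)) + 1 ≤ k := by exact_mod_cast hk
    rw [abs_le]; constructor <;> nlinarith
  · rcases lt_or_ge l ⌊t / ε⌋ with hl | hl
    · refine ⟨l, hkl, le_rfl, ?_⟩
      have : (l : ℝ) + 1 ≤ ⌊t / ε⌋ := by exact_mod_cast hl
      rw [abs_le]; constructor <;> nlinarith
    · refine ⟨⌊t / ε⌋, hk, hl, ?_⟩
      rw [abs_le]; constructor <;> nlinarith

lemma isWell_of_run (hε : 0 < ε) (h : IsSublevelSet W f lam F) {z : Fin 2 → ℤ} {j : Fin 2} {k l : ℤ}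
    (hk : k ≤ 0) (hl : 0 ≤ l) (hz : latticePoint ε z ∈ F)
    (hkF : latticePoint ε (z + Pi.single j (k - 1)) ∉ F)
    (hlF : latticePoint ε (z + Pi.single j (l + 1)) ∉ F)
    (hseg : ∀ t ∈ Icc (ε * (k - 1)) (ε * (l + 1)), latticePoint ε z + t • axis j ∈ W) :
    IsWell W f lam j (latticePoint ε z) (ε * (k - 1)) (ε * (l + 1)) := by
  rw [latticePoint_add_single] at hkF hlF
  push_cast at hkF hlF
  have hk' : (k : ℝ) ≤ 0 := by exact_mod_cast hk
  have hl' : (0 : ℝ) ≤ l := by exact_mod_cast hl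
  have h1 : ε * ((k : ℝ) - 1) ≤ 0 := by nlinarith
  have h2 : 0 ≤ ε * ((l : ℝ) + 1) := by nlinarith
  have hkW := hseg _ ⟨le_rfl, h1.trans h2⟩
  have hlW := hseg _ ⟨h1.trans h2, le_rfl⟩
  exact ⟨h1, h2, hseg, h.le _ hz, h.le_of_notMem hkW hkF, h.le_of_notMem hlW hlF,
    h.lt_of_notMem _ hz _ hkW hkF, h.lt_of_notMem _ hz _ hlW hlF⟩

lemma dist_run_le (hε : 0 < ε) {z : Fin 2 → ℤ} {j : Fin 2} {k l m : ℤ} (hkm : k ≤ m) (hml : m ≤ l)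
    {p : Plane} {d : ℝ} (hp : dist p (latticePoint ε (z + Pi.single j m)) ≤ d) :
    ∀ t ∈ Icc (ε * (k - 1)) (ε * (l + 1)),
      dist p (latticePoint ε z + t • axis j) ≤ d + ε * (l - k + 1) := by
  intro t ht
  refine (dist_triangle _ _ _).trans (add_le_add hp ?_)
  rw [latticePoint_add_single, dist_add_smul_axis, abs_le]
  have h1 : (k : ℝ) ≤ m := by exact_mod_cast hkm
  have h2 : (m : ℝ) ≤ l := by exact_mod_cast hml
  obtain ⟨h3, h4⟩ := ht
  constructor <;> nlinarith

lemma dist_latticePoint_pixelIndex_le (hε : 0 < ε) (p : Plane) :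
    dist p (latticePoint ε (pixelIndex ε p)) ≤ ε := by
  refine (dist_le_abs_add_abs _ _).trans ?_
  linarith [abs_sub_latticePoint_le hε (rfl : pixelIndex ε p = _) 0,
    abs_sub_latticePoint_le hε (rfl : pixelIndex ε p = _) 1]

lemma exists_floor_eq (hε : 0 < ε) {k l : ℤ} {t : ℝ}
    (ht : t ∈ Ico (ε * k - ε / 2) (ε * l + ε / 2)) :
    ∃ m, k ≤ m ∧ m ≤ l ∧ ⌊t / ε + 1 / 2⌋ = m := by
  refine ⟨_, ?_, ?_, rfl⟩
  · rw [Int.le_floor, ← sub_le_iff_le_add, le_div_iff₀ hε]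
    nlinarith [ht.1]
  · rw [← Int.lt_add_one_iff, Int.floor_lt, ← lt_sub_iff_add_lt, div_lt_iff₀ hε]
    push_cast
    nlinarith [ht.2]

/-! ### Pixel components away from the boundary of `W` -/

/-- In each row and each column, a component of the Gauss approximation is made of runs, at both
ends of which there is a lattice point of `W` outside of `F`. -/
lemma le_area_integral_cells {α β M : ℝ} (h : IsSublevelSet W f lam F)
    (hf : IsC11On f W) (hFb : Bornology.IsBounded F) (hα : 0 < α) (hβ : 0 < β)
    (hαβ : 2 < α + 2 * β) (hε : 0 < ε) (hM : 4 * (Metric.diam F + ε) ≤ M)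
    (hQ : Q ∈ boundedComponents (gaussApprox ε F))
    (hbox : ∀ z ∈ cells ε F Q, ∀ x : Plane, (∀ i, |x i - latticePoint ε z i| ≤ ε) → x ∈ W) :
    ENNReal.ofReal ((1 / 4) ^ 2 * M ^ (2 - α - 2 * β)) ≤
      lipConst W f ^ α *
        (lipConst W (partialOn W f 0) ^ (2 * β) + lipConst W (partialOn W f 1) ^ (2 * β)) *
        ∫⁻ x in pixelIndex ε ⁻¹' cells ε F Q, (ENNReal.ofReal
          (|f x - lam| ^ α * |partialOn W f 0 x * partialOn W f 1 x| ^ β))⁻¹ := by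
  set Z := cells ε F Q with hZdef
  have hD := Metric.diam_nonneg (s := F)
  have hwell : ∀ z ∈ Z, ∀ j, ∃ k l : ℤ, k ≤ 0 ∧ 0 ≤ l ∧
      (∀ m, k ≤ m → m ≤ l → z + Pi.single j m ∈ Z) ∧ ε * ((l : ℝ) - k) ≤ Metric.diam F ∧
      IsWell W f lam j (latticePoint ε z) (ε * (k - 1)) (ε * (l + 1)) := by
    intro z hz j
    obtain ⟨k, l, hk, hl, hrun, hkF, hlF, hdiam⟩ := exists_run hε hFb hQ hz j
    refine ⟨k, l, hk, hl, hrun, hdiam, isWell_of_run hε h hk hl hz.1 hkF hlF fun t ht => ?_⟩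
    obtain ⟨m, hkm, hml, hm⟩ := exists_int_near hε (hk.trans hl) ht
    refine hbox _ (hrun m hkm hml) _ fun i => ?_
    rw [latticePoint_add_single]
    rcases eq_or_ne i j with rfl | hij
    · rw [add_smul_axis_self, add_smul_axis_self]
      rwa [add_sub_add_left_eq_sub]
    · rw [add_smul_axis_ne _ _ hij, add_smul_axis_ne _ _ hij, sub_self, abs_zero]
      exact hε.le
  have hRm : MeasurableSet (pixelIndex ε ⁻¹' Z) :=
    measurable_pixelIndex ε (Set.to_countable Z).measurableSet
  have hRW : pixelIndex ε ⁻¹' Z ⊆ W := fun x hx => hbox _ hx x fun i =>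
    (abs_sub_latticePoint_le hε rfl i).trans (by linarith)
  set Y : Set ℝ := (fun y : ℝ => ⌊y / ε + 1 / 2⌋) ⁻¹' ((fun z : Fin 2 → ℤ => z 1) '' Z) with hYdef
  have hYm : MeasurableSet Y :=
    (Int.measurable_floor.comp (by fun_prop : Measurable fun y : ℝ => y / ε + 1 / 2))
      (Set.to_countable _).measurableSet
  obtain ⟨z₀, hz₀⟩ := cells_nonempty hε hQ
  have hYsub : Y ⊆ Icc (ε * z₀ 1 - (Metric.diam F + ε)) (ε * z₀ 1 + (Metric.diam F + ε)) := by
    rintro y ⟨z, hz, hzy⟩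
    obtain ⟨h1, h2⟩ := (floor_eq_iff_pixel hε).1 hzy.symm
    have h3 := (abs_coord_sub_le_dist (latticePoint ε z) (latticePoint ε z₀) 1).trans
      (Metric.dist_le_diam_of_mem hFb hz.1 hz₀.1)
    rw [latticePoint_apply, latticePoint_apply, abs_le] at h3
    exact ⟨by linarith [h3.1], by linarith [h3.2]⟩
  have hYle : volume Y ≤ ENNReal.ofReal (2 * (Metric.diam F + ε)) := by
    refine (measure_mono hYsub).trans_eq ?_
    rw [Real.volume_Icc]; ring_nf
  have hYfin : volume Y ≠ ∞ := (hYle.trans_lt ENNReal.ofReal_lt_top).ne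
  set b := (volume Y).toReal with hbdef
  have hYb : volume Y = ENNReal.ofReal b := (ENNReal.ofReal_toReal hYfin).symm
  have hbM : b ≤ 2 * (Metric.diam F + ε) := ENNReal.toReal_le_of_le_ofReal (by positivity) hYle
  have hvert : ∀ (z : Fin 2 → ℤ) (k l : ℤ), k ≤ l →
      (∀ m, k ≤ m → m ≤ l → z + Pi.single 1 m ∈ Z) → ε * ((l : ℝ) - k + 1) ≤ b := by
    intro z k l hkl hrun
    have h1 : Ico (ε * z 1 + (ε * k - ε / 2)) (ε * z 1 + (ε * l + ε / 2)) ⊆ Y := by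
      intro y hy
      obtain ⟨m, hkm, hml, hm⟩ := exists_floor_eq (k := k) (l := l) (t := y - ε * z 1) hε
        ⟨by linarith [hy.1], by linarith [hy.2]⟩
      refine ⟨_, hrun m hkm hml, ?_⟩
      rw [floor_eq_iff_pixel hε] at hm
      refine ((floor_eq_iff_pixel hε).2 ?_).symm
      simp only [Pi.add_apply, Pi.single_eq_same, Int.cast_add]
      constructor <;> linarith [hm.1, hm.2]
    have h2 := measure_mono (μ := volume) h1
    rw [Real.volume_Ico, hYb, ENNReal.ofReal_le_ofReal_iff ENNReal.toReal_nonneg] at h2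
    linarith
  obtain ⟨k₀, l₀, -, -, -, -, w₀⟩ := hwell z₀ hz₀ 0
  obtain ⟨k₁, l₁, hk₁, hl₁, hrun₁, -, w₁⟩ := hwell z₀ hz₀ 1
  have hlen : ∀ {k l : ℤ}, k ≤ 0 → 0 ≤ l → ε ≤ ε * ((l : ℝ) - k + 1) := by
    intro k l hk hl
    have hk' : (k : ℝ) ≤ 0 := by exact_mod_cast hk
    have hl' : (0 : ℝ) ≤ l := by exact_mod_cast hl
    nlinarith
  have hb : ε ≤ b := (hlen hk₁ hl₁).trans (hvert z₀ k₁ l₁ (hk₁.trans hl₁) hrun₁)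
  refine le_area_integral (b := 2 * b) hα hβ hαβ hf hRm hRW hYm
    (by norm_num) (by linarith) (by linarith) ?_ w₀.lipConst_ne_zero
    (w₀.lipConst_partialOn_ne_zero hf.1) (w₁.lipConst_partialOn_ne_zero hf.1) ?_
  · rw [hYb]; exact ENNReal.ofReal_le_ofReal (by linarith)
  rintro y ⟨z, hz, hzy⟩
  obtain ⟨k, l, hk, hl, hrun, hdiam, hw⟩ := hwell z hz 0
  have hkl := hlen hk hl
  refine ⟨2 * (ε * (l - k + 1)), Ico (ε * z 0 + (ε * k - ε / 2)) (ε * z 0 + (ε * l + ε / 2)),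
    by linarith, by linarith, measurableSet_Ico, ?_, ?_⟩
  · rw [Real.volume_Ico]; exact ENNReal.ofReal_le_ofReal (by linarith)
  intro x hx0 hx1
  obtain ⟨m, hkm, hml, hm⟩ := exists_floor_eq (k := k) (l := l) (t := x 0 - ε * z 0) hε
    ⟨by linarith [hx0.1], by linarith [hx0.2]⟩
  have hpix : pixelIndex ε x = z + Pi.single 0 m := by
    ext i
    fin_cases i
    · refine (floor_eq_iff_pixel hε).2 ?_
      rw [floor_eq_iff_pixel hε] at hm
      simp only [Fin.zero_eta, Pi.add_apply, Pi.single_eq_same, Int.cast_add]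
      constructor <;> linarith [hm.1, hm.2]
    · simp only [Fin.mk_one, pixelIndex, hx1, Pi.add_apply, ne_eq, one_ne_zero, not_false_eq_true,
        Pi.single_eq_of_ne, add_zero]
      exact hzy.symm
  have hxZ : pixelIndex ε x ∈ Z := hpix ▸ hrun m hkm hml
  have hxW := hRW hxZ
  have hdist := dist_latticePoint_pixelIndex_le hε x
  obtain ⟨k', l', hk', hl', hrun', -, hw'⟩ := hwell _ hxZ 1
  have hd : ∀ t ∈ Icc (ε * ((k : ℝ) - 1)) (ε * (l + 1)),
      dist x (latticePoint ε z + t • axis 0) ≤ 2 * (ε * (l - k + 1)) := fun t ht =>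
    (dist_run_le hε hkm hml (hpix ▸ hdist) t ht).trans (by linarith)
  have hd' : ∀ t ∈ Icc (ε * ((k' : ℝ) - 1)) (ε * (l' + 1)),
      dist x (latticePoint ε (pixelIndex ε x) + t • axis 1) ≤ 2 * b := fun t ht => by
    refine (dist_run_le (m := 0) hε hk' hl' (by simpa using hdist) t ht).trans ?_
    linarith [hvert _ k' l' (hk'.trans hl') hrun']
  exact ⟨hxZ, hw.abs_sub_le hf.1 hxW hd, hw'.abs_sub_le hf.1 hxW hd',
    hw.abs_partialOn_le hf.1 hxW hd, hw'.abs_partialOn_le hf.1 hxW hd'⟩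

end Runs

/-! ### Pixel components along the boundary of `W` -/

/-- In the square of radius `ε` around `c`, the set `W` is the half-plane `s * x i ≤ s * a`, which
contains `c` and whose boundary meets the open square. -/
structure IsHalfPlaneAt (W : Set Plane) (ε : ℝ) (i : Fin 2) (s a : ℝ) (c : Plane) : Prop where
  abs_lt : |a - c i| < ε
  le : s * c i ≤ s * a
  mem_iff : ∀ x : Plane, (∀ i, |x i - c i| ≤ ε) → (x ∈ W ↔ s * x i ≤ s * a)

namespace IsHalfPlaneAt

variable {W : Set Plane} {ε s a : ℝ} {i j : Fin 2} {c : Plane}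

lemma exists_beyond (h : IsHalfPlaneAt W ε i s a c) (hs : s = 1 ∨ s = -1) {d : ℝ} (hd : 0 < d) :
    ∃ η, 0 < η ∧ η < d ∧ |a + s * η - c i| ≤ ε ∧ ¬ s * (a + s * η) ≤ s * a := by
  have h1 : 0 < ε - |a - c i| := sub_pos.2 h.abs_lt
  have hm := lt_min hd h1
  have hs1 : |s| = 1 := by rcases hs with rfl | rfl <;> simp
  have hss : s * s = 1 := by rcases hs with rfl | rfl <;> norm_num
  refine ⟨min d (ε - |a - c i|) / 2, by positivity, by linarith [min_le_left d (ε - |a - c i|)],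
    ?_, ?_⟩
  · have h2 := abs_add_le (a - c i) (s * (min d (ε - |a - c i|) / 2))
    rw [abs_mul, hs1, one_mul, abs_of_pos (a := min d (ε - |a - c i|) / 2) (by positivity)] at h2
    rw [show a + s * (min d (ε - |a - c i|) / 2) - c i =
      a - c i + s * (min d (ε - |a - c i|) / 2) by ring]
    linarith [min_le_right d (ε - |a - c i|)]
  · rw [mul_add, ← mul_assoc, hss]
    linarith

lemma mem_frontier (h : IsHalfPlaneAt W ε i s a c) (hs : s = 1 ∨ s = -1) {x : Plane}
    (hx : ∀ i, |x i - c i| ≤ ε) (hxa : x i = a) : x ∈ frontier W := by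
  refine ⟨subset_closure ((h.mem_iff x hx).2 (by rw [hxa])), fun hint => ?_⟩
  obtain ⟨d, hd, hB⟩ := Metric.isOpen_iff.1 isOpen_interior x hint
  obtain ⟨η, hη, hηd, h1, h2⟩ := h.exists_beyond hs hd
  have hmem : x + (s * η) • axis i ∈ W := by
    refine interior_subset (hB ?_)
    have h3 := dist_add_smul_axis x (s * η) 0 i
    rw [zero_smul, add_zero, sub_zero, abs_mul, abs_of_pos hη] at h3
    rw [Metric.mem_ball, h3]
    rcases hs with rfl | rfl <;> simpa using hηd
  rw [h.mem_iff, add_smul_axis_self, hxa] at hmem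
  · exact h2 hmem
  · intro k
    rcases eq_or_ne k i with rfl | hk
    · rw [add_smul_axis_self, hxa]; exact h1
    · rw [add_smul_axis_ne _ _ hk]; exact hx k

/-- The same half-plane is seen from the neighbouring lattice point in the direction of the
boundary line, unless there is a corner nearby. -/
lemma step (h : IsHalfPlaneAt W ε i s a c) (hs : s = 1 ∨ s = -1) (hε : 0 < ε) {t : ℝ} (hji : j ≠ i)
    (ht : |t| ≤ ε) (hc : c + t • axis j ∈ W)
    (hstr : (∀ x : Plane, (∀ k, |x k - (c + t • axis j) k| ≤ ε) → x ∉ W) ∨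
      (∀ x : Plane, (∀ k, |x k - (c + t • axis j) k| ≤ ε) → x ∈ W) ∨
      ∃ (i : Fin 2) (s a : ℝ), (s = 1 ∨ s = -1) ∧ |a - (c + t • axis j) i| ≤ ε ∧
        ∀ x : Plane, (∀ k, |x k - (c + t • axis j) k| ≤ ε) → (x ∈ W ↔ s * x i ≤ s * a)) :
    IsHalfPlaneAt W ε i s a (c + t • axis j) := by
  set c' := c + t • axis j with hc'
  have hci : c' i = c i := add_smul_axis_ne _ _ hji.symm
  have hcj : c' j = c j + t := add_smul_axis_self _ _ _
  -- points of the square around `c'` on the line through `c'` parallel to the `i`-th axis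
  have hbox' : ∀ u : ℝ, |u| ≤ ε → ∀ k, |(c' + u • axis i) k - c' k| ≤ ε := by
    intro u hu k
    rcases eq_or_ne k i with rfl | hk
    · rwa [add_smul_axis_self, add_sub_cancel_left]
    · rw [add_smul_axis_ne _ _ hk, sub_self, abs_zero]; exact hε.le
  have hbox : ∀ u : ℝ, |u| ≤ ε → ∀ k, |(c' + u • axis i) k - c k| ≤ ε := by
    intro u hu k
    rcases eq_or_ne k i with rfl | hk
    · rwa [add_smul_axis_self, hci, add_sub_cancel_left]
    · have hkj : k = j := by omega
      subst hkj
      rwa [add_smul_axis_ne _ _ hk, hcj, add_sub_cancel_left]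
  have hline : ∀ u : ℝ, |u| ≤ ε → (c' + u • axis i ∈ W ↔ s * (c i + u) ≤ s * a) := by
    intro u hu
    rw [h.mem_iff _ (hbox u hu), add_smul_axis_self, hci]
  obtain ⟨η, hη, -, h1, h2⟩ := h.exists_beyond hs one_pos
  have hout : c' + (a + s * η - c i) • axis i ∉ W := by
    rw [hline _ h1, add_sub_cancel]; exact h2
  refine ⟨by rw [hci]; exact h.abs_lt, by rw [hci]; exact h.le, fun x hx => ?_⟩
  rcases hstr with hstr | hstr | ⟨i', s', a', -, -, hstr⟩
  · exact absurd hc (hstr _ fun k => by simpa using hε.le)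
  · exact absurd (hstr _ (hbox' _ h1)) hout
  · rcases eq_or_ne i' i with rfl | hi'
    · have hu : |x i' - c i'| ≤ ε := by rw [← hci]; exact hx i'
      have e1 := hline _ hu
      rw [hstr _ (hbox' _ hu), add_smul_axis_self, hci, add_sub_cancel] at e1
      rw [hstr x hx]
      exact e1
    · exfalso
      have hc2 := (hstr c' fun k => by simpa using hε.le).1 hc
      rw [hstr _ (hbox' _ h1), add_smul_axis_ne _ _ hi'] at hout
      exact hout hc2

end IsHalfPlaneAt

/-- The index of the lattice point whose pixel row or column a point of a boundary line
`x i = const` is attributed to, the set `W` being on the side `s * x i ≤ s * const`. -/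
noncomputable def edgeIndex (ε : ℝ) (i : Fin 2) (s : ℝ) (x : Plane) : Fin 2 → ℤ :=
  Function.update (pixelIndex ε x) i (if s = 1 then ⌊x i / ε⌋ else ⌈x i / ε⌉)

lemma edgeIndex_eq {W : Set Plane} {ε s a : ℝ} (hε : 0 < ε) {i j : Fin 2} (hji : j ≠ i)
    (hs : s = 1 ∨ s = -1) {z : Fin 2 → ℤ} (h : IsHalfPlaneAt W ε i s a (latticePoint ε z))
    {x : Plane} (hxi : x i = a) (hxj : ⌊x j / ε + 1 / 2⌋ = z j) : edgeIndex ε i s x = z := by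
  ext k
  rcases eq_or_ne k i with rfl | hk
  · have h1 := h.abs_lt
    have h2 := h.le
    rw [latticePoint_apply, abs_lt] at h1
    rw [latticePoint_apply] at h2
    rw [edgeIndex, Function.update_self, hxi]
    rcases hs with rfl | rfl
    · rw [if_pos rfl, Int.floor_eq_iff, le_div_iff₀ hε, div_lt_iff₀ hε]
      constructor <;> nlinarith
    · rw [if_neg (by norm_num), Int.ceil_eq_iff, lt_div_iff₀ hε, div_le_iff₀ hε]
      constructor <;> nlinarith
  · have hkj : k = j := by omega
    subst hkj
    rw [edgeIndex, Function.update_of_ne hk]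
    exact hxj

/-- A component of the Gauss approximation one of whose lattice points sees a straight piece of
the boundary of `W` owns the segment of the boundary next to a run of its pixels. -/
lemma le_edge_integral_cells {W F Q : Set Plane} {f : Plane → ℝ} {lam ε α β M s a : ℝ}
    {i j : Fin 2} (h : IsSublevelSet W f lam F) (hW : IsClosed W)
    (hf : IsC11On f W) (hFb : Bornology.IsBounded F) (hα : 0 < α) (hβ : 0 < β)
    (hαβ : 1 < α + β) (hε : 0 < ε) (hM : 4 * (Metric.diam F + ε) ≤ M)
    (hQ : Q ∈ boundedComponents (gaussApprox ε F))
    (hstr : ∀ z ∈ cells ε F Q,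
      (∀ x : Plane, (∀ i, |x i - latticePoint ε z i| ≤ ε) → x ∉ W) ∨
      (∀ x : Plane, (∀ i, |x i - latticePoint ε z i| ≤ ε) → x ∈ W) ∨
      ∃ (i : Fin 2) (s a : ℝ), (s = 1 ∨ s = -1) ∧ |a - latticePoint ε z i| ≤ ε ∧
        ∀ x : Plane, (∀ i, |x i - latticePoint ε z i| ≤ ε) → (x ∈ W ↔ s * x i ≤ s * a))
    (hji : j ≠ i) (hs : s = 1 ∨ s = -1) {z : Fin 2 → ℤ} (hz : z ∈ cells ε F Q)
    (hhalf : IsHalfPlaneAt W ε i s a (latticePoint ε z)) :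
    ∃ S : Set Plane, MeasurableSet S ∧ S ⊆ edgeIndex ε i s ⁻¹' cells ε F Q ∧
      S ⊆ frontier W ∧ ENNReal.ofReal (1 / 4 * M ^ (1 - α - β)) ≤
      lipConst W f ^ α * lipConst W (partialOn W f j) ^ β *
        ∫⁻ x in S, (ENNReal.ofReal (|f x - lam| ^ α * |partialOn W f j x| ^ β))⁻¹
          ∂(Measure.hausdorffMeasure 1) := by
  have hfW : frontier W ⊆ W := hW.frontier_subset
  obtain ⟨k, l, hk, hl, hrun, hkF, hlF, hdiam⟩ := exists_run hε hFb hQ hz j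
  have hstep : ∀ m n : ℤ, |n| = 1 → z + Pi.single j (m + n) ∈ cells ε F Q →
      IsHalfPlaneAt W ε i s a (latticePoint ε (z + Pi.single j m)) →
      IsHalfPlaneAt W ε i s a (latticePoint ε (z + Pi.single j (m + n))) := by
    intro m n hn hmem hm
    have h1 := hstr _ hmem
    have h2 := h.subset hmem.1
    rw [Pi.single_add, ← add_assoc, latticePoint_add_single] at h1 h2 ⊢
    refine hm.step hs hε hji ?_ h2 h1
    rw [abs_mul, abs_of_pos hε, ← Int.cast_abs, hn, Int.cast_one, mul_one]
  have hhalf' : ∀ m, k ≤ m → m ≤ l →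
      IsHalfPlaneAt W ε i s a (latticePoint ε (z + Pi.single j m)) := by
    have hup : ∀ m : ℤ, 0 ≤ m → m ≤ l →
        IsHalfPlaneAt W ε i s a (latticePoint ε (z + Pi.single j m)) := by
      intro m hm
      induction m, hm using Int.leInduction with
      | base => intro _; simpa using hhalf
      | succ m hm ih =>
        intro hml
        exact hstep m 1 (by simp) (hrun _ (by omega) hml) (ih (by omega))
    have hdown : ∀ m : ℤ, m ≤ 0 → k ≤ m →
        IsHalfPlaneAt W ε i s a (latticePoint ε (z + Pi.single j m)) := by
      intro m hm
      induction m, hm using Int.leInductionDown with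
      | base => intro _; simpa using hhalf
      | pred m hm ih =>
        intro hmk
        exact hstep m (-1) (by simp) (hrun _ hmk (by omega)) (ih (by omega))
    intro m hkm hml
    rcases le_total 0 m with h0 | h0
    · exact hup m h0 hml
    · exact hdown m h0 hkm
  have hboxrun : ∀ (x : Plane) (m : ℤ) (t : ℝ), |x i - latticePoint ε z i| ≤ ε →
      x j = ε * z j + t → |t - ε * m| ≤ ε →
      ∀ n, |x n - latticePoint ε (z + Pi.single j m) n| ≤ ε := by
    intro x m t hxi hxj ht n
    rw [latticePoint_add_single]
    rcases eq_or_ne n j with rfl | hn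
    · rw [add_smul_axis_self, hxj, latticePoint_apply, add_sub_add_left_eq_sub]; exact ht
    · have hni : n = i := by omega
      subst hni
      rw [add_smul_axis_ne _ _ hn]; exact hxi
  have hw : IsWell W f lam j (latticePoint ε z) (ε * (k - 1)) (ε * (l + 1)) := by
    refine isWell_of_run hε h hk hl hz.1 hkF hlF fun t ht => ?_
    obtain ⟨m, hkm, hml, hm⟩ := exists_int_near hε (hk.trans hl) ht
    have hi : (latticePoint ε z + t • axis j) i = latticePoint ε z i :=
      add_smul_axis_ne _ _ hji.symm
    rw [(hhalf' m hkm hml).mem_iff _ (hboxrun _ m t (by rw [hi, sub_self, abs_zero]; exact hε.le)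
      (add_smul_axis_self _ _ _) hm), hi]
    exact hhalf.le
  have hk' : (k : ℝ) ≤ 0 := by exact_mod_cast hk
  have hl' : (0 : ℝ) ≤ l := by exact_mod_cast hl
  have hN : ε ≤ ε * ((l : ℝ) - k + 1) := by nlinarith
  -- the orthogonal projection of the lattice point onto the boundary line
  set c : Plane := latticePoint ε z + (a - latticePoint ε z i) • axis i with hc
  have hci : ∀ t : ℝ, (c + t • axis j) i = a := fun t => by
    rw [add_smul_axis_ne _ _ hji.symm, hc, add_smul_axis_self, add_sub_cancel]
  have hcj : ∀ t : ℝ, (c + t • axis j) j = ε * z j + t := fun t => by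
    rw [add_smul_axis_self, hc, add_smul_axis_ne _ _ hji, latticePoint_apply]
  set T : Set ℝ := Ico (ε * k - ε / 2) (ε * l + ε / 2) with hT
  have hpt : ∀ t ∈ T, ∃ m, k ≤ m ∧ m ≤ l ∧ |t - ε * m| ≤ ε / 2 ∧
      edgeIndex ε i s (c + t • axis j) = z + Pi.single j m ∧ c + t • axis j ∈ frontier W := by
    intro t ht
    obtain ⟨m, hkm, hml, hm⟩ := exists_floor_eq hε ht
    have hm' := (floor_eq_iff_pixel hε).1 hm
    have habs : |t - ε * m| ≤ ε / 2 := by rw [abs_le]; constructor <;> linarith [hm'.1, hm'.2]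
    refine ⟨m, hkm, hml, habs, edgeIndex_eq hε hji hs (hhalf' m hkm hml) (hci t) ?_,
      (hhalf' m hkm hml).mem_frontier hs (hboxrun _ m t ?_ (hcj t) (by linarith)) (hci t)⟩
    · rw [floor_eq_iff_pixel hε, hcj]
      simp only [Pi.add_apply, Pi.single_eq_same, Int.cast_add]
      constructor <;> linarith [hm'.1, hm'.2]
    · rw [hci]; exact hhalf.abs_lt.le
  have hSfr : (fun t : ℝ => c + t • axis j) '' T ⊆ frontier W := by
    rintro _ ⟨t, ht, rfl⟩
    obtain ⟨m, -, -, -, -, hm⟩ := hpt t ht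
    exact hm
  refine ⟨(fun t : ℝ => c + t • axis j) '' T, measurableSet_image_axis c j measurableSet_Ico, ?_,
    hSfr, ?_⟩
  · rintro _ ⟨t, ht, rfl⟩
    obtain ⟨m, hkm, hml, -, hm, -⟩ := hpt t ht
    rw [mem_preimage, hm]
    exact hrun m hkm hml
  rw [mul_assoc]
  refine le_edge_integral (s := 4 * (ε * (l - k + 1))) hα hβ hαβ hf
    (measurableSet_image_axis c j measurableSet_Ico) (hSfr.trans hfW) (by norm_num) (by linarith)
    (by linarith) ?_ hw.lipConst_ne_zero (hw.lipConst_partialOn_ne_zero hf.1) ?_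
  · rw [hausdorffMeasure_image_axis, Real.volume_Ico]
    exact ENNReal.ofReal_le_ofReal (by linarith)
  · rintro _ ⟨t, ht, rfl⟩
    obtain ⟨m, hkm, hml, habs, -, hfr⟩ := hpt t ht
    have hdist : dist (c + t • axis j) (latticePoint ε (z + Pi.single j m)) ≤ ε + ε := by
      have h1 := hboxrun (c + t • axis j) m t (by rw [hci]; exact hhalf.abs_lt.le) (hcj t)
        (by linarith)
      exact (dist_le_abs_add_abs _ _).trans (add_le_add (h1 0) (h1 1))
    have hd : ∀ u ∈ Icc (ε * ((k : ℝ) - 1)) (ε * (l + 1)),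
        dist (c + t • axis j) (latticePoint ε z + u • axis j) ≤ 4 * (ε * (l - k + 1)) :=
      fun u hu => (dist_run_le hε hkm hml hdist u hu).trans (by linarith)
    exact ⟨hw.abs_sub_le hf.1 (hfW hfr) hd, hw.abs_partialOn_le hf.1 (hfW hfr) hd⟩

/-! ### Counting components -/

lemma toENNReal_encard_iUnion_le {ι X : Type*} [Fintype ι] (s : ι → Set X) :
    ((⋃ i, s i).encard : ℝ≥0∞) ≤ ∑ i, ((s i).encard : ℝ≥0∞) := by
  have h := ENat.toENNReal_mono (Set.encard_iUnion_le_of_fintype s)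
  exact h.trans_eq (map_sum ENat.toENNRealRingHom _ _)

section Counting

variable {W F : Set Plane} {f : Plane → ℝ} {lam α β M : ℝ}

lemma encard_mul_le_boundaryTerm {ι : Type*} {𝒞 : Set ι} {j : Fin 2} {c : ℝ≥0∞}
    {P : ι → Set Plane}
    (hP : 𝒞.PairwiseDisjoint P)
    (h : ∀ Q ∈ 𝒞, ∃ S : Set Plane, MeasurableSet S ∧ S ⊆ P Q ∧ S ⊆ frontier W ∧ c ≤
      lipConst W f ^ α * lipConst W (partialOn W f j) ^ β *
        ∫⁻ x in S, (ENNReal.ofReal (|f x - lam| ^ α * |partialOn W f j x| ^ β))⁻¹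
          ∂(Measure.hausdorffMeasure 1)) :
    (𝒞.encard : ℝ≥0∞) * c ≤ boundaryTerm W f lam α β := by
  choose! S hm hSP hSW hc using h
  refine le_trans ?_ (edge_term_le_boundaryTerm (W := W) (f := f) (lam := lam) j)
  rw [← mul_assoc]
  exact encard_mul_le_of_disjoint (hP.mono_on hSP) hm hSW hc

/-- The bound for the components of `F` itself: those that contain a corner, those in the interior
of `W`, and those that meet the frontier of `W` along an edge parallel to one of the axes. -/
lemma encard_boundedComponents_le {α' β' : ℝ} (h : IsSublevelSet W f lam F) (hW : IsClosed W)
    (hf : IsC11On f W) (hgrad : ∀ x ∈ relFrontier W F, fderivWithin ℝ f W x ≠ 0)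
    (hFb : Bornology.IsBounded F) (hα : 0 < α) (hβ : 0 < β) (hαβ : 2 < α + 2 * β)
    (hα' : 0 < α') (hβ' : 0 < β') (hαβ' : 1 < α' + β') (hM : 2 * Metric.diam F ≤ M)
    (hfin : boundaryTerm W f lam α' β' ≠ ∞) :
    ∃ 𝒜 ℬ 𝒟 : Set (Set Plane), boundedComponents F ⊆ 𝒜 ∪ ℬ ∪ 𝒟 ∧
      (𝒜.encard : ℝ≥0∞) * ENNReal.ofReal ((1 / 4) ^ 2 * M ^ (2 - α - 2 * β)) ≤
        areaTerm W f lam α β ∧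
      (ℬ.encard : ℝ≥0∞) * ENNReal.ofReal (1 / 4 * M ^ (1 - α' - β')) ≤
        4 * boundaryTerm W f lam α' β' ∧
      𝒟.encard ≤ 9 * (corners W).encard := by
  have hdisj : (boundedComponents F).PairwiseDisjoint id := fun K hK K' hK' hne => by
    rw [Function.onFun, Set.disjoint_left]
    exact fun x hx hx' => hne (boundedComponents_eq_of_mem hK hK' hx hx')
  let ℬ : Fin 2 → Set (Set Plane) := fun j => {K ∈ boundedComponents F |
    ∃ S : Set Plane, MeasurableSet S ∧ S ⊆ K ∧ S ⊆ frontier W ∧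
      ENNReal.ofReal (1 / 4 * M ^ (1 - α' - β')) ≤
      lipConst W f ^ α' * lipConst W (partialOn W f j) ^ β' *
        ∫⁻ x in S, (ENNReal.ofReal (|f x - lam| ^ α' * |partialOn W f j x| ^ β'))⁻¹
          ∂(Measure.hausdorffMeasure 1)}
  have hD := Metric.diam_nonneg (s := F)
  refine ⟨{K ∈ boundedComponents F | ∀ p ∈ K, p ∉ frontier W}, ⋃ j, ℬ j,
    {K ∈ boundedComponents F | ∃ p ∈ corners W, p ∈ K}, fun K hK => ?_, ?_, ?_, ?_⟩
  · by_cases hc : ∃ p ∈ corners W, p ∈ K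
    · exact Or.inr ⟨hK, hc⟩
    refine Or.inl ?_
    by_cases hfr : ∀ p ∈ K, p ∉ frontier W
    · exact Or.inl ⟨hK, hfr⟩
    refine Or.inr (mem_iUnion.2 ?_)
    push Not at hc hfr
    obtain ⟨p, hpK, hpW⟩ := hfr
    obtain ⟨x, hx, rfl⟩ := hK.1
    have hKc : ∀ p ∈ connectedComponentIn F x, p ∉ corners W := fun p hp hpc => hc p hpc hp
    obtain ⟨q, hqK, hqW, hql⟩ : ∃ q ∈ connectedComponentIn F x, q ∈ frontier W ∧ f q ≠ lam := by
      by_contra! hcon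
      exact hfin (h.boundaryTerm_eq_top hW hf hFb hα' hβ' hαβ' hx hKc ⟨p, hpK, hpW⟩ hcon)
    have hql' : f q < lam := lt_of_le_of_ne (h.le q (connectedComponentIn_subset _ _ hqK)) hql
    obtain ⟨j, S, hS⟩ := h.le_edge_integral_component (M := M) hW hf hFb hα' hβ' hαβ' (by linarith)
      hx hKc hqK hqW hql'
    exact ⟨j, hK, S, hS⟩
  · have hsub : ∀ K : Set Plane, interior K ∩ f ⁻¹' Iio lam ⊆ K :=
      fun K y hy => interior_subset hy.1
    refine encard_mul_le_of_disjoint (R := fun K => interior K ∩ f ⁻¹' Iio lam)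
      ((hdisj.subset (sep_subset _ _)).mono_on fun K _ => hsub K) ?_ ?_ ?_
    all_goals rintro K ⟨⟨⟨x, hx, rfl⟩, -⟩, hK⟩
    · exact (h.le_area_integral_component hW hf hgrad hFb hα hβ hαβ hM hx hK).1
    · exact (hsub _).trans ((connectedComponentIn_subset F x).trans h.subset)
    · exact (h.le_area_integral_component hW hf hgrad hFb hα hβ hαβ hM hx hK).2
  · have hj : ∀ j, ((ℬ j).encard : ℝ≥0∞) * ENNReal.ofReal (1 / 4 * M ^ (1 - α' - β')) ≤
        boundaryTerm W f lam α' β' := fun j =>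
      encard_mul_le_boundaryTerm (hdisj.subset (sep_subset _ _)) fun K hK => hK.2
    have h1 := toENNReal_encard_iUnion_le ℬ
    calc _ ≤ (∑ j, ((ℬ j).encard : ℝ≥0∞)) * ENNReal.ofReal (1 / 4 * M ^ (1 - α' - β')) := by gcongr
      _ ≤ ∑ j : Fin 2, boundaryTerm W f lam α' β' := by
          rw [Finset.sum_mul]; exact Finset.sum_le_sum fun j _ => hj j
      _ ≤ _ := by
          rw [Finset.sum_const, Finset.card_univ, Fintype.card_fin, nsmul_eq_mul]
          gcongr
          norm_num
  · have key : ∀ K ∈ {K ∈ boundedComponents F | ∃ p ∈ corners W, p ∈ K},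
        ∃ p ∈ corners W, p ∈ K := fun K hK => hK.2
    choose! p hp hpK using key
    refine le_trans (Set.encard_le_encard_of_injOn (f := p) (fun K hK => hp K hK)
      fun K hK K' hK' he => ?_) (le_mul_of_one_le_left' (by norm_num))
    exact boundedComponents_eq_of_mem hK.1 hK'.1 (hpK K hK) (he ▸ hpK K' hK')

/-- The bound for the components of the Gauss approximation: those with a corner near one of their
lattice points, those well inside `W`, and those along one of the four types of edges. -/
lemma encard_boundedComponents_gaussApprox_le {α' β' ε : ℝ} (h : IsSublevelSet W f lam F)
    (hW : IsClosed W) (hf : IsC11On f W)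
    (hFb : Bornology.IsBounded F) (hα : 0 < α) (hβ : 0 < β) (hαβ : 2 < α + 2 * β)
    (hα' : 0 < α') (hβ' : 0 < β') (hαβ' : 1 < α' + β') (hε : 0 < ε)
    (hM : 4 * (Metric.diam F + ε) ≤ M)
    (hstr : ∀ z : Plane,
      (∃ p ∈ corners W, ∀ i, |p i - z i| ≤ ε) ∨
      (∀ x : Plane, (∀ i, |x i - z i| ≤ ε) → x ∉ W) ∨
      (∀ x : Plane, (∀ i, |x i - z i| ≤ ε) → x ∈ W) ∨
      ∃ (i : Fin 2) (s a : ℝ), (s = 1 ∨ s = -1) ∧ |a - z i| ≤ ε ∧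
        ∀ x : Plane, (∀ i, |x i - z i| ≤ ε) → (x ∈ W ↔ s * x i ≤ s * a)) :
    ∃ 𝒜 ℬ 𝒟 : Set (Set Plane), boundedComponents (gaussApprox ε F) ⊆ 𝒜 ∪ ℬ ∪ 𝒟 ∧
      (𝒜.encard : ℝ≥0∞) * ENNReal.ofReal ((1 / 4) ^ 2 * M ^ (2 - α - 2 * β)) ≤
        areaTerm W f lam α β ∧
      (ℬ.encard : ℝ≥0∞) * ENNReal.ofReal (1 / 4 * M ^ (1 - α' - β')) ≤
        4 * boundaryTerm W f lam α' β' ∧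
      𝒟.encard ≤ 9 * (corners W).encard := by
  have hdisj : ∀ φ : Plane → Fin 2 → ℤ, (boundedComponents (gaussApprox ε F)).PairwiseDisjoint
      fun Q => φ ⁻¹' cells ε F Q := fun φ Q hQ Q' hQ' hne => by
    rw [Function.onFun, Set.disjoint_left]
    exact fun x hx hx' => hne (cells_unique hQ hQ' hx hx')
  let σ : Bool → ℝ := fun b => if b then 1 else -1
  let ℬ : Fin 2 × Bool → Set (Set Plane) := fun ib => {Q ∈ boundedComponents (gaussApprox ε F) |
    ∃ S : Set Plane, MeasurableSet S ∧ S ⊆ edgeIndex ε ib.1 (σ ib.2) ⁻¹' cells ε F Q ∧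
      S ⊆ frontier W ∧ ENNReal.ofReal (1 / 4 * M ^ (1 - α' - β')) ≤
      lipConst W f ^ α' * lipConst W (partialOn W f (1 - ib.1)) ^ β' *
        ∫⁻ x in S, (ENNReal.ofReal (|f x - lam| ^ α' * |partialOn W f (1 - ib.1) x| ^ β'))⁻¹
          ∂(Measure.hausdorffMeasure 1)}
  refine ⟨{Q ∈ boundedComponents (gaussApprox ε F) | ∀ z ∈ cells ε F Q, ∀ x : Plane,
      (∀ i, |x i - latticePoint ε z i| ≤ ε) → x ∈ W}, ⋃ ib, ℬ ib,
    {Q ∈ boundedComponents (gaussApprox ε F) | ∃ z ∈ cells ε F Q, ∃ p ∈ corners W,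
      ∀ i, |p i - latticePoint ε z i| ≤ ε}, fun Q hQ => ?_, ?_, ?_, ?_⟩
  · by_cases hc : ∃ z ∈ cells ε F Q, ∃ p ∈ corners W, ∀ i, |p i - latticePoint ε z i| ≤ ε
    · exact Or.inr ⟨hQ, hc⟩
    refine Or.inl ?_
    by_cases hbox : ∀ z ∈ cells ε F Q, ∀ x : Plane,
      (∀ i, |x i - latticePoint ε z i| ≤ ε) → x ∈ W
    · exact Or.inl ⟨hQ, hbox⟩
    refine Or.inr (mem_iUnion.2 ?_)
    have hstr' := fun z (hz : z ∈ cells ε F Q) =>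
      (hstr (latticePoint ε z)).resolve_left fun hp => hc ⟨z, hz, hp⟩
    push Not at hbox
    obtain ⟨z, hz, x, hx, hxW⟩ := hbox
    have hzW := h.subset hz.1
    have hself : ∀ i, |latticePoint ε z i - latticePoint ε z i| ≤ ε := fun i => by
      simpa using hε.le
    rcases hstr' z hz with hno | hall | ⟨i, s, a, hs, ha, hiff⟩
    · exact absurd hzW (hno _ hself)
    · exact absurd (hall x hx) hxW
    have hle := (hiff _ hself).1 hzW
    have hlt : |a - latticePoint ε z i| < ε := by
      refine lt_of_le_of_ne ha fun heq => hxW ((hiff x hx).2 ?_)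
      have h1 := abs_le.1 (hx i)
      rcases hs with rfl | rfl
      · rw [abs_of_nonneg (a := a - _) (by linarith)] at heq
        linarith [h1.2]
      · rw [abs_of_nonpos (a := a - _) (by linarith)] at heq
        linarith [h1.1]
    obtain ⟨b, rfl⟩ : ∃ b, s = σ b := by
      rcases hs with rfl | rfl
      · exact ⟨true, rfl⟩
      · exact ⟨false, rfl⟩
    exact ⟨(i, b), hQ, le_edge_integral_cells h hW hf hFb hα' hβ' hαβ' hε hM hQ hstr'
      (show 1 - i ≠ i by omega) hs hz ⟨hlt, hle, hiff⟩⟩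
  · refine encard_mul_le_of_disjoint ((hdisj (pixelIndex ε)).subset (sep_subset _ _))
      (fun Q _ => measurable_pixelIndex ε (Set.to_countable _).measurableSet)
      (fun Q hQ x hx => ?_)
      (fun Q hQ => le_area_integral_cells h hf hFb hα hβ hαβ hε hM hQ.1 hQ.2)
    exact hQ.2 _ hx x fun i => (abs_sub_latticePoint_le hε rfl i).trans (by linarith)
  · have hj : ∀ ib, ((ℬ ib).encard : ℝ≥0∞) * ENNReal.ofReal (1 / 4 * M ^ (1 - α' - β')) ≤
        boundaryTerm W f lam α' β' := fun ib =>
      encard_mul_le_boundaryTerm ((hdisj _).subset (sep_subset _ _)) fun Q hQ => hQ.2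
    have h1 := toENNReal_encard_iUnion_le ℬ
    calc _ ≤ (∑ ib, ((ℬ ib).encard : ℝ≥0∞)) * ENNReal.ofReal (1 / 4 * M ^ (1 - α' - β')) := by
          gcongr
      _ ≤ ∑ ib : Fin 2 × Bool, boundaryTerm W f lam α' β' := by
          rw [Finset.sum_mul]; exact Finset.sum_le_sum fun ib _ => hj ib
      _ = _ := by
          rw [Finset.sum_const, Finset.card_univ, nsmul_eq_mul]
          norm_num
  · -- a component is determined by a corner and the relative position of one of its lattice points
    have key : ∀ Q ∈ {Q ∈ boundedComponents (gaussApprox ε F) | ∃ z ∈ cells ε F Q,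
        ∃ p ∈ corners W, ∀ i, |p i - latticePoint ε z i| ≤ ε},
        ∃ (z : Fin 2 → ℤ) (p : Plane), z ∈ cells ε F Q ∧ p ∈ corners W ∧
          ∀ i, |p i - latticePoint ε z i| ≤ ε := by
      rintro Q ⟨-, z, hz, p, hp⟩
      exact ⟨z, p, hz, hp⟩
    choose! z p hz hp hzp using key
    set O : Finset (Fin 2 → ℤ) := Fintype.piFinset fun _ => Finset.Icc (-1) 1 with hO
    have hOcard : (O : Set (Fin 2 → ℤ)).encard = 9 := by
      rw [Set.encard_coe_eq_coe_finsetCard, hO, Fintype.card_piFinset]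
      simp
    rw [← hOcard, ← Set.encard_prod]
    refine Set.encard_le_encard_of_injOn (f := fun Q => (fun i => z Q i - ⌊p Q i / ε⌋, p Q)) ?_ ?_
    · intro Q hQ
      refine ⟨?_, hp Q hQ⟩
      rw [Finset.mem_coe, hO, Fintype.mem_piFinset]
      intro i
      have h1 := hzp Q hQ i
      rw [latticePoint_apply, abs_le] at h1
      have h2 := Int.floor_le (p Q i / ε)
      have h3 := Int.lt_floor_add_one (p Q i / ε)
      rw [le_div_iff₀ hε] at h2
      rw [div_lt_iff₀ hε] at h3
      rw [Finset.mem_Icc]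
      constructor
      · have : ((⌊p Q i / ε⌋ : ℝ) - 1) * ε ≤ z Q i * ε := by linarith [h1.2]
        have := le_of_mul_le_mul_right this hε
        have : ⌊p Q i / ε⌋ - 1 ≤ z Q i := by exact_mod_cast this
        linarith
      · have : (z Q i : ℝ) * ε < ((⌊p Q i / ε⌋ : ℝ) + 2) * ε := by linarith [h1.1]
        have := lt_of_mul_lt_mul_right this hε.le
        have : z Q i < ⌊p Q i / ε⌋ + 2 := by exact_mod_cast this
        linarith
    · intro Q hQ Q' hQ' he
      obtain ⟨h1, h2⟩ := Prod.ext_iff.1 he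
      have h2 : p Q = p Q' := h2
      have h3 : z Q = z Q' := by
        ext i
        have := congrFun h1 i
        simp only [h2] at this
        linarith
      exact cells_unique hQ.1 hQ'.1 (hz Q hQ) (h3 ▸ hz Q' hQ')

lemma encard_le_of_subset_union {𝒞 𝒜 ℬ 𝒟 : Set (Set Plane)} {I I' : ℝ≥0∞} {N : ℕ∞} {a e : ℝ}
    (ha : 0 < a) (he : 0 < e) (h : 𝒞 ⊆ 𝒜 ∪ ℬ ∪ 𝒟)
    (h𝒜 : (𝒜.encard : ℝ≥0∞) * ENNReal.ofReal a ≤ I)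
    (hℬ : (ℬ.encard : ℝ≥0∞) * ENNReal.ofReal e ≤ 4 * I') (h𝒟 : 𝒟.encard ≤ 9 * N) :
    (𝒞.encard : ℝ≥0∞) ≤ ENNReal.ofReal (a⁻¹ + 4 * e⁻¹ + 9) * (I + I' + N) := by
  have h1 : (𝒜.encard : ℝ≥0∞) ≤ ENNReal.ofReal a⁻¹ * I := by
    rw [ENNReal.ofReal_inv_of_pos ha, mul_comm, ← div_eq_mul_inv]
    exact (ENNReal.le_div_iff_mul_le (Or.inl (by simpa using ha))
      (Or.inl ENNReal.ofReal_ne_top)).2 h𝒜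
  have h2 : (ℬ.encard : ℝ≥0∞) ≤ ENNReal.ofReal (4 * e⁻¹) * I' := by
    rw [ENNReal.ofReal_mul (by norm_num), ENNReal.ofReal_inv_of_pos he,
      mul_assoc, mul_left_comm, mul_comm, ← div_eq_mul_inv]
    refine (ENNReal.le_div_iff_mul_le (Or.inl (by simpa using he))
      (Or.inl ENNReal.ofReal_ne_top)).2 (hℬ.trans_eq ?_)
    norm_num
  have h3 : (𝒟.encard : ℝ≥0∞) ≤ ENNReal.ofReal 9 * N := by
    have := ENat.toENNReal_mono h𝒟
    rw [ENat.toENNReal_mul] at this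
    simpa using this
  have h4 : (𝒞.encard : ℝ≥0∞) ≤ 𝒜.encard + ℬ.encard + 𝒟.encard := by
    have h5 : 𝒞.encard ≤ 𝒜.encard + ℬ.encard + 𝒟.encard :=
      (Set.encard_le_encard h).trans ((Set.encard_union_le _ _).trans
        (add_le_add_left (Set.encard_union_le _ _) _))
    have := ENat.toENNReal_mono h5
    simpa using this
  have ha' : 0 < a⁻¹ := inv_pos.2 ha
  have he' : 0 < e⁻¹ := inv_pos.2 he
  calc (𝒞.encard : ℝ≥0∞) ≤ ENNReal.ofReal a⁻¹ * I + ENNReal.ofReal (4 * e⁻¹) * I' +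
        ENNReal.ofReal 9 * N := h4.trans (by gcongr)
    _ ≤ ENNReal.ofReal (a⁻¹ + 4 * e⁻¹ + 9) * I + ENNReal.ofReal (a⁻¹ + 4 * e⁻¹ + 9) * I' +
        ENNReal.ofReal (a⁻¹ + 4 * e⁻¹ + 9) * N := by
        gcongr <;> linarith
    _ = _ := by ring

end Counting

theorem theorem2p2 :
    ∃ ε₀ : Set Plane → ℝ, (∀ W, IsPolyrectangle W → 0 < ε₀ W) ∧
      ∀ α β α' β' : ℝ, 0 < α → 0 < β → 0 < α' → 0 < β' →
        2 < α + 2 * β → 1 < α' + β' →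
        ∃ C : ℝ → ℝ, (∀ D, 0 < C D) ∧
          ∀ W : Set Plane, IsPolyrectangle W →
          ∀ f : Plane → ℝ, IsC11On f W →
          ∀ (lam : ℝ) (F : Set Plane),
            (F = sublevel W f lam ∨ F = strictSublevel W f lam) →
            (∀ x ∈ relFrontier W F, fderivWithin ℝ f W x ≠ 0) →
            Bornology.IsBounded (F ∩ W) →
            ∀ ε : ℝ, 0 < ε → ε < ε₀ W →
              max ((boundedComponents (gaussApprox ε (F ∩ W))).encard : ℝ≥0∞)
                  ((boundedComponents (F ∩ W)).encard : ℝ≥0∞) ≤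
                ENNReal.ofReal (C (Metric.diam (F ∩ W))) *
                  (areaTerm W f lam α β + boundaryTerm W f lam α' β' +
                    ((corners W).encard : ℝ≥0∞)) := by
  have hloc := fun (W : Set Plane) (hW : IsPolyrectangle W) => hW.exists_local_structure
  choose! δ hδ hstr using hloc
  refine ⟨fun W => min 1 (δ W), fun W hW => lt_min one_pos (hδ W hW), ?_⟩
  intro α β α' β' hα hβ hα' hβ' hαβ hαβ'
  refine ⟨fun D => ((1 / 4) ^ 2 * (4 * (|D| + 1)) ^ (2 - α - 2 * β))⁻¹ +
    4 * (1 / 4 * (4 * (|D| + 1)) ^ (1 - α' - β'))⁻¹ + 9, fun D => by positivity, ?_⟩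
  intro W hW f hf lam F hF hgrad hFb ε hε hεW
  have h := isSublevelSet_of_eq hF
  rw [inter_eq_left.2 h.subset] at hFb ⊢
  have hD := Metric.diam_nonneg (s := F)
  have hM : 0 < 4 * (|Metric.diam F| + 1) := by positivity
  have hε1 : ε < 1 := hεW.trans_le (min_le_left _ _)
  rw [abs_of_nonneg hD] at hM
  by_cases hfin : boundaryTerm W f lam α' β' = ∞
  · rw [hfin, add_top, top_add, ENNReal.mul_top]
    · exact le_top
    · rw [Ne, ENNReal.ofReal_eq_zero, not_le]
      positivity
  · refine max_le ?_ ?_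
    · obtain ⟨𝒜, ℬ, 𝒟, h1, h2, h3, h4⟩ := encard_boundedComponents_gaussApprox_le
        (M := 4 * (Metric.diam F + 1)) h hW.isClosed hf hFb hα hβ hαβ hα' hβ' hαβ' hε
        (by linarith) fun z => hstr W hW z ε hε (hεW.trans_le (min_le_right _ _))
      simp only [abs_of_nonneg hD]
      exact encard_le_of_subset_union (by positivity) (by positivity) h1 h2 h3 h4
    · obtain ⟨𝒜, ℬ, 𝒟, h1, h2, h3, h4⟩ := encard_boundedComponents_le
        (M := 4 * (Metric.diam F + 1)) h hW.isClosed hf hgrad hFb hα hβ hαβ hα' hβ' hαβ'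
        (by linarith) hfin
      simp only [abs_of_nonneg hD]
      exact encard_le_of_subset_union (by positivity) (by positivity) h1 h2 h3 h4
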